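/- Let $\mathbb D=\{z\in\mathbb C:|z|<1\}$. A complex-valued harmonic function $f$ on $\mathbb D$ can be written $f=h+\overline g$ with $h,g$ analytic on $\mathbb D$, and $h',g'$ are uniquely determined by $f$. It is called sense-preserving in $\mathbb D$ if, at every $z_0\in\mathbb D$, $h'$ does not vanish identically near $z_0$ and $\omega=g'/h'$ (removable singularities being removed) is analytic at $z_0$ with $|\omega(z_0)|<1$. Let $\mathcal T_H^O$ be the class of all sense-preserving harmonic functions $f=h+\overline g$ on $\mathbb D$ such that $f(z)$ is real if and only if $z$ is real, $f(0)=0$, $|h'(0)|=1$, $g'(0)=0$, and $f(r)>0$ for $0<r<1$. For $|\eta|=1$ and $-1\le t\le 1$ put $$\mathbf p_\eta(z)=\frac{1+\eta z}{1-\eta z},\qquad \mathbf q_t(z)=\frac{z}{1-2tz+z^2}\qquad(z\in\mathbb D),$$ and for analytic functions $p,F$ on $\mathbb D$ put $$k(z,p,F)=\operatorname{Re}\int_0^z p(\zeta)F'(\zeta)\,d\zeta+i\operatorname{Im}F(z)\qquad(z\in\mathbb D).$$ **Theorem.** The class $\mathcal T_H^O$ is compact in the topology of uniform convergence on the compact subsets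 of $\mathbb D$. The set of its extreme points, that is, of those $f\in\mathcal T_H^O$ that are not of the form $(1-\lambda)f_1+\lambda f_2$ with $0<\lambda<1$ and distinct $f_1,f_2\in\mathcal T_H^O$, is exactly $$\{k(\cdot,\mathbf p_\eta,\mathbf q_t):|\eta|=1,\ -1\le t\le 1\}.$$ The class $\mathcal T_H^O$ is not convex. -/

import Mathlib

open Metric Set Filter Topology
open scoped ComplexConjugate Interval UniformConvergence

noncomputable section

/-- The open unit disk in the complex plane. -/
abbrev unitDisk : Set ℂ := ball (0 : ℂ) 1

/-- The centre of the disk, as a point of the disk. -/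
def diskCenter : unitDisk := ⟨0, mem_ball_self one_pos⟩

/-- `f` is a complex-valued harmonic function on the unit disk. (The function `u` only serves
to extend `f` by arbitrary values outside the open disk, where they play no role.) -/
def IsHarmonicMapping (f : unitDisk → ℂ) : Prop :=
  ∃ u : ℂ → ℂ, InnerProductSpace.HarmonicOnNhd u unitDisk ∧ ∀ z : unitDisk, f z = u z

/-- `f = h + conj g` with `h` and `g` analytic on the unit disk. The functions `h` and `g` are
determined by `f` on the disk up to additive constants, so `h'` and `g'` are determined by `f`. -/
structure IsDecomposition (f : unitDisk → ℂ) (h g : ℂ → ℂ) : Prop where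
  analytic_h : AnalyticOnNhd ℂ h unitDisk
  analytic_g : AnalyticOnNhd ℂ g unitDisk
  eq : ∀ z : unitDisk, f z = h z + conj (g z)

/-- `h + conj g` is sense-preserving at `z`: the derivative `h'` does not vanish identically
near `z`, and the dilatation `ω = g' / h'` is (after removal of a singularity) analytic at `z`
with `|ω z| < 1`. -/
def SensePreservingAt (h g : ℂ → ℂ) (z : ℂ) : Prop :=
  (¬ ∀ᶠ w in 𝓝 z, deriv h w = 0) ∧
    ∃ ω : ℂ → ℂ, AnalyticAt ℂ ω z ∧ (∀ᶠ w in 𝓝 z, deriv g w = ω w * deriv h w) ∧ ‖ω z‖ < 1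

/-- `f = h + conj g` is a typically real, sense-preserving harmonic function on the unit disk
with `f 0 = 0`, `|h' 0| = 1` and `f r > 0` for `0 < r < 1`. -/
structure IsTypicallyRealHarmonic (f : unitDisk → ℂ) (h g : ℂ → ℂ) : Prop where
  harmonic : IsHarmonicMapping f
  decomposition : IsDecomposition f h g
  sensePreserving : ∀ z ∈ unitDisk, SensePreservingAt h g z
  real_iff : ∀ z : unitDisk, (f z).im = 0 ↔ (z : ℂ).im = 0
  map_zero : f diskCenter = 0
  norm_deriv_zero : ‖deriv h 0‖ = 1
  pos : ∀ z : unitDisk, (z : ℂ).im = 0 → 0 < (z : ℂ).re → (f z).im = 0 ∧ 0 < (f z).re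

/-- The class `𝒯_H` of typically real harmonic functions on the unit disk. -/
def classTH : Set (unitDisk → ℂ) :=
  {f | ∃ h g : ℂ → ℂ, IsTypicallyRealHarmonic f h g}

/-- The subclass `𝒯_H^O` of `𝒯_H` given by the additional normalization `g' 0 = 0`. -/
def classTHO : Set (unitDisk → ℂ) :=
  {f | ∃ h g : ℂ → ℂ, IsTypicallyRealHarmonic f h g ∧ deriv g 0 = 0}

/-- The Herglotz kernel `z ↦ (1 + η z) / (1 - η z)`. -/
def herglotzKernel (η : ℂ) (z : ℂ) : ℂ := (1 + η * z) / (1 - η * z)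

/-- The function `z ↦ z / (1 - 2 t z + z ^ 2)`. -/
def robertsonKernel (t : ℝ) (z : ℂ) : ℂ := z / (1 - 2 * (t : ℂ) * z + z ^ 2)

/-- The shear `k(z, p, F) = Re ∫₀ᶻ p(ζ) F'(ζ) dζ + i Im F(z)`, with the integral taken along the
segment from `0` to `z` (for analytic `p` and `F` the path in the disk does not matter). -/
def shear (p F : ℂ → ℂ) (z : ℂ) : ℂ :=
  ((∫ s in (0 : ℝ)..1, p (s * z) * deriv F (s * z) * z).re : ℂ) + Complex.I * ((F z).im : ℂ)

/-- A set of functions on the unit disk is compact in the topology of uniform convergence on the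
compact subsets of the disk. -/
def IsCompactLocallyUniformly (A : Set (unitDisk → ℂ)) : Prop :=
  IsCompact (UniformOnFun.ofFun {K : Set unitDisk | IsCompact K} '' A)

end

/-!
A function of the class is a shear `Re H + i Im F` with `H' = p F'`, `H 0 = 0`, where
`F = h - g` is a normalized typically real function and `p = (h' + g') / (h' - g')` is in the
Carathéodory class, and every such shear belongs to the class (`exists_isShear`,
`IsShear.mem_classTHO`). The pair `(p, F)` is determined by the function, and the correspondence is
affine in `p` and in `F` separately.

*Compactness.* Both classes of analytic functions are locally bounded, so by a version of Montel's
theorem the data `p`, `F`, `H` converge locally uniformly along every ultrafilter, and the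
conditions defining a shear pass to the limit.

*Extreme points.* As the correspondence is affine in each variable, the data of an extreme point
are extreme in their classes. For the converse, comparing the imaginary parts gives `F` first,
then `p`. So the theorem reduces to the extreme points of the two classes of analytic functions.
These are usually obtained from the integral representations of Herglotz and Robertson; here the
operations on the representing measures which one needs are carried out on the functions. Multiplying
the measure by a nonnegative function of `cos θ` multiplies the boundary values of `Re p` or `Im F`
by this function, so that the minimum principle shows that the result is again in the cone
(`IsCaratheodory.re_add_cosTransform_nonneg`, `IsTypicallyReal.add_cosShift`,
`IsTypicallyReal.isTypicallyReal_sqShift`). With the factors `1 ± cos θ` a function is split into a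
convex combination, which (after a suitable rotation, in the case of the Carathéodory class) is
trivial for a combination of at most two kernels only. Conversely, the Herglotz kernels are
extreme because they are the only functions with a first coefficient of modulus `2`, and the
Robertson kernels because they are the only functions on the parabola `e = d ^ 2 - 1`, where `d`
and `e` are the second and third coefficient and `e ≥ d ^ 2 - 1` throughout the class; this
inequality comes from the factor `(cos θ - s) ^ 2`.

*Failure of convexity.* The midpoint of the shears for `(η, t) = (1, 1)` and `(-1, -1)` has
`h' - g' = 0`, but `h' + g' ≠ 0`, at the point `i (√2 - 1)`.
-/

/-! ### Minimum principles for real and imaginary parts -/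

lemma re_nonneg_of_frontier {U : Set ℂ} (hU : Bornology.IsBounded U) {G : ℂ → ℂ}
    (hd : DiffContOnCl ℂ G U) (hf : ∀ z ∈ frontier U, 0 ≤ (G z).re) {z : ℂ}
    (hz : z ∈ closure U) : 0 ≤ (G z).re := by
  have h1 : DiffContOnCl ℂ (fun z => Complex.exp (-G z)) U :=
    ⟨hd.differentiableOn.neg.cexp, hd.continuousOn.neg.cexp⟩
  have h2 := Complex.norm_le_of_forall_mem_frontier_norm_le hU h1 (C := 1)
    (fun w hw => by simpa [Complex.norm_exp] using hf w hw) hz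
  simpa [Complex.norm_exp] using h2

lemma isConnected_unitDisk : IsConnected unitDisk :=
  (convex_ball (0 : ℂ) 1).isConnected ⟨0, mem_ball_self one_pos⟩

lemma zero_mem_unitDisk : (0 : ℂ) ∈ unitDisk := mem_ball_self one_pos

lemma mem_unitDisk {z : ℂ} : z ∈ unitDisk ↔ ‖z‖ < 1 := mem_ball_zero_iff

/-- Strong minimum principle: a nonnegative real part that vanishes at one point belongs to a
constant function. -/
lemma eq_of_re_nonneg_of_re_eq_zero {U : Set ℂ} (hU : IsOpen U) (hc : IsConnected U) {G : ℂ → ℂ}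
    (hd : DifferentiableOn ℂ G U) (hG : ∀ z ∈ U, 0 ≤ (G z).re) {z₀ : ℂ} (hz₀ : z₀ ∈ U)
    (h0 : (G z₀).re = 0) {z : ℂ} (hz : z ∈ U) : G z = G z₀ := by
  have h1 : EqOn (norm ∘ fun z => Complex.exp (-G z))
      (Function.const ℂ ‖Complex.exp (-G z₀)‖) U :=
    Complex.norm_eqOn_of_isPreconnected_of_isMaxOn hc.isPreconnected hU
      hd.neg.cexp hz₀ (fun w hw => by simpa [Complex.norm_exp, h0] using hG w hw)
  have h2 : ∀ w ∈ U, (G w).re = 0 := fun w hw => by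
    simpa [Complex.norm_exp, h0] using h1 hw
  obtain ⟨c, hc'⟩ := AnalyticOnNhd.eq_const_of_re_eq_const (hd.analyticOnNhd hU) h2 hU hc
  rw [hc' z hz, hc' z₀ hz₀]

lemma differentiableOn_dilation {F : ℂ → ℂ} (hF : DifferentiableOn ℂ F unitDisk) {ρ : ℝ}
    (hρ : ρ ∈ Ioo (0 : ℝ) 1) :
    DifferentiableOn ℂ (fun z => F (ρ * z)) (closedBall (0 : ℂ) 1) := by
  refine hF.comp (by fun_prop) fun z hz => ?_
  rw [mem_unitDisk, norm_mul, Complex.norm_real, Real.norm_of_nonneg hρ.1.le]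
  have := mem_closedBall_zero_iff.1 hz
  nlinarith [hρ.1, hρ.2, norm_nonneg z]

lemma dilation_mem {z : ℂ} (hz : ‖z‖ ≤ 1) {ρ : ℝ} (hρ : ρ ∈ Ioo (0 : ℝ) 1) :
    (ρ : ℂ) * z ∈ unitDisk := by
  rw [mem_unitDisk, norm_mul, Complex.norm_real, Real.norm_of_nonneg hρ.1.le]
  nlinarith [hρ.1, hρ.2, norm_nonneg z]

lemma tendsto_dilation {F : ℂ → ℂ} (hF : DifferentiableOn ℂ F unitDisk) {z : ℂ}
    (hz : z ∈ unitDisk) :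
    Tendsto (fun ρ : ℝ => F (ρ * z)) (𝓝[<] 1) (𝓝 (F z)) := by
  have h1 : ContinuousAt F z := (hF.differentiableAt (isOpen_ball.mem_nhds hz)).continuousAt
  have h2 : Tendsto (fun ρ : ℝ => (ρ : ℂ) * z) (𝓝[<] 1) (𝓝 z) := by
    have : ContinuousAt (fun ρ : ℝ => (ρ : ℂ) * z) 1 := by fun_prop
    simpa using this.tendsto.mono_left nhdsWithin_le_nhds
  exact h1.tendsto.comp h2

lemma tendsto_ofReal_one : Tendsto (fun ρ : ℝ => (ρ : ℂ)) (𝓝[<] 1) (𝓝 1) := by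
  have : ContinuousAt (fun ρ : ℝ => (ρ : ℂ)) 1 := by fun_prop
  simpa using this.tendsto.mono_left nhdsWithin_le_nhds

lemma eventually_mem_Ioo : ∀ᶠ ρ in 𝓝[<] (1 : ℝ), ρ ∈ Ioo (0 : ℝ) 1 :=
  Ioo_mem_nhdsLT one_pos

/-- Minimum principle for a limit of functions which are analytic on the closed disk. -/
lemma re_nonneg_of_tendsto {G : ℝ → ℂ → ℂ} {G₁ : ℂ → ℂ}
    (hd : ∀ ρ ∈ Ioo (0 : ℝ) 1, DifferentiableOn ℂ (G ρ) (closedBall 0 1))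
    (hb : ∀ ρ ∈ Ioo (0 : ℝ) 1, ∀ z : ℂ, ‖z‖ = 1 → 0 ≤ (G ρ z).re) {z : ℂ} (hz : z ∈ unitDisk)
    (ht : Tendsto (fun ρ => G ρ z) (𝓝[<] 1) (𝓝 (G₁ z))) : 0 ≤ (G₁ z).re := by
  refine ge_of_tendsto ((Complex.continuous_re.tendsto _).comp ht) ?_
  filter_upwards [eventually_mem_Ioo] with ρ hρ
  refine re_nonneg_of_frontier isBounded_ball (U := unitDisk) ?_ ?_ (subset_closure hz)
  · refine DifferentiableOn.diffContOnCl ?_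
    rw [closure_ball _ one_ne_zero]; exact hd ρ hρ
  · intro w hw
    rw [frontier_ball _ one_ne_zero] at hw
    exact hb ρ hρ w (mem_sphere_zero_iff_norm.1 hw)

lemma im_nonneg_of_upper_half {G : ℂ → ℂ} (hd : DifferentiableOn ℂ G (closedBall 0 1))
    (hr : ∀ z ∈ closedBall (0 : ℂ) 1, z.im = 0 → (G z).im = 0)
    (hb : ∀ z : ℂ, ‖z‖ = 1 → 0 ≤ z.im * (G z).im) {z : ℂ} (hz : z ∈ unitDisk) (hi : 0 < z.im) :
    0 ≤ (G z).im := by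
  set U : Set ℂ := unitDisk ∩ {w | 0 < w.im}
  have hop : IsOpen {w : ℂ | 0 < w.im} := isOpen_lt continuous_const Complex.continuous_im
  have hcl : closure U ⊆ closedBall 0 1 ∩ {w | 0 ≤ w.im} :=
    closure_minimal (inter_subset_inter ball_subset_closedBall fun w (hw : 0 < w.im) => hw.le)
      (isClosed_closedBall.inter (isClosed_le continuous_const Complex.continuous_im))
  have key := re_nonneg_of_frontier (U := U) (G := fun w => -Complex.I * G w) (z := z)
    (isBounded_ball.subset inter_subset_left)
    (DifferentiableOn.diffContOnCl ((hd.mono fun w hw => (hcl hw).1).const_mul _)) ?_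
    (subset_closure ⟨hz, hi⟩)
  · simpa using key
  · intro w hw
    have h1 := hcl (frontier_subset_closure hw)
    have h2 : w ∉ U := by
      rw [(isOpen_ball.inter hop).frontier_eq] at hw
      exact hw.2
    have h3 : 0 ≤ (G w).im := by
      rcases (show 0 ≤ w.im from h1.2).eq_or_lt with h | h
      · exact (hr w h1.1 h.symm).ge
      · have h4 : ‖w‖ = 1 := by
          refine le_antisymm (mem_closedBall_zero_iff.1 h1.1) (not_lt.1 fun h5 => h2 ⟨?_, h⟩)
          exact mem_unitDisk.2 h5
        exact nonneg_of_mul_nonneg_right (hb w h4) h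
    simpa using h3

/-- If `Im z * Im (G z)` is nonnegative on the unit circle and `G` is real on the real axis, then
`Im z * Im (G z)` is nonnegative in the disk. -/
lemma im_mul_im_nonneg {G : ℂ → ℂ} (hd : DifferentiableOn ℂ G (closedBall 0 1))
    (hr : ∀ z ∈ closedBall (0 : ℂ) 1, z.im = 0 → (G z).im = 0)
    (hb : ∀ z : ℂ, ‖z‖ = 1 → 0 ≤ z.im * (G z).im) {z : ℂ} (hz : z ∈ unitDisk) :
    0 ≤ z.im * (G z).im := by
  rcases lt_trichotomy z.im 0 with hi | hi | hi
  · have h := im_nonneg_of_upper_half (G := fun w => -G (-w)) (z := -z)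
      ((hd.comp (differentiableOn_neg _) fun w hw => by simpa using hw).neg)
      (fun w hw h => by simpa using hr (-w) (by simpa using hw) (by simpa using h))
      (fun w hw => by simpa using hb (-w) (by simpa using hw)) (by simpa using hz) (by simpa using hi)
    simp only [neg_neg, Complex.neg_im] at h
    nlinarith
  · simp [hi]
  · exact mul_nonneg hi.le (im_nonneg_of_upper_half hd hr hb hz hi)

lemma im_mul_im_nonneg_of_tendsto {G : ℝ → ℂ → ℂ} {G₁ : ℂ → ℂ}
    (hd : ∀ ρ ∈ Ioo (0 : ℝ) 1, DifferentiableOn ℂ (G ρ) (closedBall 0 1))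
    (hr : ∀ ρ ∈ Ioo (0 : ℝ) 1, ∀ z ∈ closedBall (0 : ℂ) 1, z.im = 0 → (G ρ z).im = 0)
    (hb : ∀ ρ ∈ Ioo (0 : ℝ) 1, ∀ z : ℂ, ‖z‖ = 1 → 0 ≤ z.im * (G ρ z).im) {z : ℂ}
    (hz : z ∈ unitDisk) (ht : Tendsto (fun ρ => G ρ z) (𝓝[<] 1) (𝓝 (G₁ z))) :
    0 ≤ z.im * (G₁ z).im := by
  refine ge_of_tendsto (((Complex.continuous_im.tendsto _).comp ht).const_mul z.im) ?_
  filter_upwards [eventually_mem_Ioo] with ρ hρ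
  exact im_mul_im_nonneg (hd ρ hρ) (hr ρ hρ) (hb ρ hρ) hz

/-! ### The difference quotient at the origin -/

lemma differentiableOn_dslope_zero {F : ℂ → ℂ} (hF : DifferentiableOn ℂ F unitDisk) :
    DifferentiableOn ℂ (dslope F 0) unitDisk :=
  (Complex.differentiableOn_dslope (isOpen_ball.mem_nhds zero_mem_unitDisk)).2 hF

lemma eq_add_mul_dslope (F : ℂ → ℂ) (z : ℂ) : F z = F 0 + z * dslope F 0 z := by
  have := sub_smul_dslope F 0 z
  simp only [sub_zero, smul_eq_mul] at this
  rw [this]; ring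

/-- The difference quotient at the origin of an analytic function that is real on the real axis
is real on the real axis. -/
lemma im_dslope_eq_zero {F : ℂ → ℂ} (hF : DifferentiableOn ℂ F unitDisk)
    (hr : ∀ z ∈ unitDisk, z.im = 0 → (F z).im = 0) :
    ∀ z ∈ unitDisk, z.im = 0 → (dslope F 0 z).im = 0 := by
  have hne : ∀ z ∈ unitDisk, z.im = 0 → z ≠ 0 → (dslope F 0 z).im = 0 := by
    intro z hz hi h0
    have hre : z.re ≠ 0 := fun h => h0 (Complex.ext h hi)
    have h1 := congrArg Complex.im (eq_add_mul_dslope F z)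
    rw [hr z hz hi, Complex.add_im, hr 0 zero_mem_unitDisk rfl, Complex.mul_im, hi] at h1
    simpa [hre] using h1.symm
  intro z hz hi
  by_cases h0 : z = 0
  · subst h0
    have hc : ContinuousAt (dslope F 0) 0 := ((differentiableOn_dslope_zero hF).differentiableAt
      (isOpen_ball.mem_nhds zero_mem_unitDisk)).continuousAt
    have h2 : Tendsto (fun x : ℝ => (x : ℂ)) (𝓝[>] 0) (𝓝 0) := by
      have : ContinuousAt (fun x : ℝ => (x : ℂ)) 0 := by fun_prop
      simpa using this.tendsto.mono_left nhdsWithin_le_nhds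
    have h3 := (Complex.continuous_im.tendsto _).comp (hc.tendsto.comp h2)
    refine tendsto_nhds_unique_of_eventuallyEq h3 tendsto_const_nhds ?_
    filter_upwards [Ioo_mem_nhdsGT (one_pos : (0 : ℝ) < 1)] with x hx
    refine hne _ ?_ (Complex.ofReal_im x) (Complex.ofReal_ne_zero.2 hx.1.ne')
    rw [mem_unitDisk, Complex.norm_real, Real.norm_of_nonneg hx.1.le]
    exact hx.2
  · exact hne z hz hi h0

lemma dslope_eq_on_disk {F G : ℂ → ℂ} (h : EqOn F G unitDisk) :
    EqOn (dslope F 0) (dslope G 0) unitDisk := by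
  intro z hz
  by_cases h0 : z = 0
  · subst h0
    rw [dslope_same, dslope_same]
    exact (h.eventuallyEq_of_mem (isOpen_ball.mem_nhds hz)).deriv_eq
  · rw [dslope_of_ne _ h0, dslope_of_ne _ h0, slope_def_field, slope_def_field, h hz,
      h zero_mem_unitDisk]

lemma dslope_lin_comb {F G : ℂ → ℂ} (hF : DifferentiableOn ℂ F unitDisk)
    (hG : DifferentiableOn ℂ G unitDisk) (a b : ℂ) (z : ℂ) :
    dslope (fun z => a * F z + b * G z) 0 z = a * dslope F 0 z + b * dslope G 0 z := by
  have hF0 := hF.differentiableAt (isOpen_ball.mem_nhds zero_mem_unitDisk)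
  have hG0 := hG.differentiableAt (isOpen_ball.mem_nhds zero_mem_unitDisk)
  by_cases h0 : z = 0
  · subst h0
    rw [dslope_same, dslope_same, dslope_same]
    exact ((hF0.hasDerivAt.const_mul a).add (hG0.hasDerivAt.const_mul b)).deriv
  · rw [dslope_of_ne _ h0, dslope_of_ne _ h0, dslope_of_ne _ h0, slope_def_field, slope_def_field,
      slope_def_field]
    ring

/-! ### The Carathéodory class -/

/-- The Carathéodory class: analytic functions `p` on the unit disk with `p 0 = 1` and nonnegative
real part. (The real part is then positive, see `IsCaratheodory.re_pos`.) -/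
structure IsCaratheodory (p : ℂ → ℂ) : Prop where
  diff : DifferentiableOn ℂ p unitDisk
  map_zero : p 0 = 1
  re_nonneg : ∀ z ∈ unitDisk, 0 ≤ (p z).re

lemma IsCaratheodory.re_pos {p : ℂ → ℂ} (hp : IsCaratheodory p) {z : ℂ} (hz : z ∈ unitDisk) :
    0 < (p z).re := by
  refine (hp.re_nonneg z hz).lt_of_ne fun h => ?_
  have h1 := eq_of_re_nonneg_of_re_eq_zero isOpen_ball isConnected_unitDisk hp.diff hp.re_nonneg
    hz h.symm zero_mem_unitDisk
  rw [hp.map_zero] at h1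
  rw [← h1] at h
  norm_num at h

lemma IsCaratheodory.norm_le {p : ℂ → ℂ} (hp : IsCaratheodory p) {z : ℂ} {r : ℝ} (hr : r < 1)
    (hz : ‖z‖ ≤ r) : ‖p z‖ ≤ 3 / (1 - r) + 1 := by
  have h := Complex.borelCaratheodory_zero (M := 1) (R := 1) (f := fun w => 1 - p w) (z := z)
    one_pos (hp.diff.const_sub 1) (fun w hw => by simpa using hp.re_nonneg w hw) one_pos
    (mem_unitDisk.2 (hz.trans_lt hr)) (by simp [hp.map_zero])
  have h1 : 2 * 1 * ‖z‖ / (1 - ‖z‖) ≤ 3 / (1 - r) := by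
    gcongr
    linarith
  calc ‖p z‖ = ‖1 - (1 - p z)‖ := by ring_nf
    _ ≤ ‖(1 : ℂ)‖ + ‖1 - p z‖ := norm_sub_le _ _
    _ ≤ 3 / (1 - r) + 1 := by rw [norm_one]; linarith

lemma norm_mul_lt_one {η z : ℂ} (hη : ‖η‖ = 1) (hz : z ∈ unitDisk) : ‖η * z‖ < 1 := by
  rw [norm_mul, hη, one_mul]; exact mem_unitDisk.1 hz

lemma one_sub_ne_zero {w : ℂ} (hw : ‖w‖ < 1) : 1 - w ≠ 0 := fun h => by
  rw [← sub_eq_zero.1 h, norm_one] at hw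
  exact lt_irrefl _ hw

lemma re_one_add_div_one_sub_nonneg {w : ℂ} (hw : ‖w‖ < 1) : 0 ≤ ((1 + w) / (1 - w)).re := by
  have h1 : w.re * w.re + w.im * w.im < 1 := by
    rw [← Complex.normSq_apply, Complex.normSq_eq_norm_sq]
    nlinarith [norm_nonneg w]
  rw [Complex.div_re, ← add_div]
  refine div_nonneg ?_ (Complex.normSq_nonneg _)
  simp
  nlinarith

lemma isCaratheodory_herglotzKernel {η : ℂ} (hη : ‖η‖ = 1) :
    IsCaratheodory (herglotzKernel η) where
  diff := by
    unfold herglotzKernel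
    refine DifferentiableOn.div (by fun_prop) (by fun_prop) fun z hz => ?_
    exact one_sub_ne_zero (norm_mul_lt_one hη hz)
  map_zero := by simp [herglotzKernel]
  re_nonneg z hz := re_one_add_div_one_sub_nonneg (norm_mul_lt_one hη hz)

/-- For `p` in the Carathéodory class with Herglotz measure `μ`, this is, up to an imaginary
constant, the analytic function with Herglotz measure `cos θ dμ`. Away from the origin it equals
`((z + 1/z) * p z - (1/z - z)) / 2`, see `two_mul_cosTransform`. -/
noncomputable def cosTransform (p : ℂ → ℂ) (z : ℂ) : ℂ := (dslope p 0 z + z * (p z + 1)) / 2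

lemma two_mul_cosTransform {p : ℂ → ℂ} (hp : p 0 = 1) (z : ℂ) :
    2 * z * cosTransform p z = (1 + z ^ 2) * p z - (1 - z ^ 2) := by
  have := eq_add_mul_dslope p z
  rw [hp] at this
  unfold cosTransform
  linear_combination -this

lemma cosTransform_zero (p : ℂ → ℂ) : cosTransform p 0 = deriv p 0 / 2 := by
  simp [cosTransform, dslope_same]

lemma differentiableOn_cosTransform {p : ℂ → ℂ} (hp : DifferentiableOn ℂ p unitDisk) :
    DifferentiableOn ℂ (cosTransform p) unitDisk := by
  have := differentiableOn_dslope_zero hp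
  unfold cosTransform
  fun_prop

lemma mul_conj_eq_one {z : ℂ} (hz : ‖z‖ = 1) : z * conj z = 1 := by
  rw [Complex.mul_conj, Complex.normSq_eq_norm_sq, hz]; norm_num

/-- On the unit circle the real part of `p + s * cosTransform p` is `(1 + s cos θ) * Re p`. -/
lemma IsCaratheodory.re_add_cosTransform_nonneg {p : ℂ → ℂ} (hp : IsCaratheodory p) {s : ℝ}
    (hs : |s| ≤ 1) {z : ℂ} (hz : z ∈ unitDisk) : 0 ≤ (p z + s * cosTransform p z).re := by
  have hD := differentiableOn_dslope_zero hp.diff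
  refine re_nonneg_of_tendsto (G₁ := fun z => p z + s * cosTransform p z)
    (G := fun ρ z => p (ρ * z) + s * ((ρ * dslope p 0 (ρ * z) + z * (p (ρ * z) + 1)) / 2))
    ?_ ?_ hz ?_
  · intro ρ hρ
    have h1 := differentiableOn_dilation hp.diff hρ
    have h2 := differentiableOn_dilation hD hρ
    exact h1.add ((((h2.const_mul _).add (differentiableOn_id.mul (h1.add_const 1))).div_const
      2).const_mul _)
  · intro ρ hρ z hz
    have h1 := eq_add_mul_dslope p (ρ * z)
    rw [hp.map_zero] at h1
    have h2 := hp.re_nonneg _ (dilation_mem hz.le hρ)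
    set P := p (ρ * z)
    set d := dslope p 0 (ρ * z)
    have h3 := mul_conj_eq_one hz
    have h4 : P + s * ((ρ * d + z * (P + 1)) / 2) =
        ((1 + s * z.re : ℝ) : ℂ) * P + Complex.I * ((s * z.im : ℝ) : ℂ) := by
      have e1 : z + conj z = 2 * (z.re : ℂ) := by rw [Complex.add_conj]; push_cast; ring
      have e2 : z - conj z = 2 * z.im * Complex.I := by rw [Complex.sub_conj]; push_cast; ring
      push_cast
      linear_combination (s / 2 : ℂ) * P * e1 + (s / 2 : ℂ) * e2 - (s / 2 : ℂ) * (ρ * d) * h3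
        - (s / 2 : ℂ) * conj z * h1
    rw [h4]
    have h5 : |z.re| ≤ 1 := (Complex.abs_re_le_norm z).trans hz.le
    have h6 : |s * z.re| ≤ 1 := by
      rw [abs_mul]; exact mul_le_one₀ hs (abs_nonneg _) h5
    rw [Complex.add_re, Complex.re_ofReal_mul, Complex.I_mul_re, Complex.ofReal_im, neg_zero,
      add_zero]
    exact mul_nonneg (by linarith [(abs_le.1 h6).1]) h2
  · have h1 := tendsto_dilation hp.diff hz
    have h2 := tendsto_dilation hD hz
    have h3 := tendsto_ofReal_one
    have h4 := h1.add (((h3.mul h2).add ((h1.add_const 1).const_mul z)).div_const 2 |>.const_mul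
      (s : ℂ))
    simpa [cosTransform] using h4

lemma IsCaratheodory.rotate {p : ℂ → ℂ} (hp : IsCaratheodory p) {η : ℂ} (hη : ‖η‖ = 1) :
    IsCaratheodory (fun z => p (η * z)) where
  diff := hp.diff.comp (by fun_prop) fun z hz => mem_unitDisk.2 (norm_mul_lt_one hη hz)
  map_zero := by simp [hp.map_zero]
  re_nonneg z hz := hp.re_nonneg _ (mem_unitDisk.2 (norm_mul_lt_one hη hz))

lemma IsCaratheodory.abs_re_deriv_le {p : ℂ → ℂ} (hp : IsCaratheodory p) :
    |(deriv p 0).re| ≤ 2 := by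
  have h1 := hp.re_add_cosTransform_nonneg (s := 1) (by norm_num) zero_mem_unitDisk
  have h2 := hp.re_add_cosTransform_nonneg (s := -1) (by norm_num) zero_mem_unitDisk
  rw [cosTransform_zero, hp.map_zero] at h1 h2
  simp at h1 h2
  rw [abs_le]
  constructor <;> linarith

lemma exists_unit_mul_eq_norm (a : ℂ) : ∃ η : ℂ, ‖η‖ = 1 ∧ η * a = ‖a‖ := by
  by_cases h : a = 0
  · exact ⟨1, by simp, by simp [h]⟩
  · have h0 : (‖a‖ : ℂ) ≠ 0 := by simpa using h
    refine ⟨‖a‖ / a, ?_, by field_simp⟩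
    rw [norm_div, Complex.norm_real, norm_norm, div_self (by simpa using h)]

/-- The first coefficient of a function in the Carathéodory class is bounded by `2`. -/
lemma IsCaratheodory.norm_deriv_le {p : ℂ → ℂ} (hp : IsCaratheodory p) : ‖deriv p 0‖ ≤ 2 := by
  obtain ⟨η, hη, h⟩ := exists_unit_mul_eq_norm (deriv p 0)
  have h1 := (hp.rotate hη).abs_re_deriv_le
  rw [deriv_comp_mul_left, mul_zero, smul_eq_mul, h, Complex.ofReal_re, abs_norm] at h1
  exact h1

/-- The half-plane map `(1 + z) / (1 - z)` is the only function in the Carathéodory class with first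
coefficient `2`. -/
lemma IsCaratheodory.eq_of_deriv_eq_two {p : ℂ → ℂ} (hp : IsCaratheodory p)
    (h : deriv p 0 = 2) {z : ℂ} (hz : z ∈ unitDisk) : p z = (1 + z) / (1 - z) := by
  have h0 : (p 0 + ((-1 : ℝ) : ℂ) * cosTransform p 0) = 0 := by
    rw [cosTransform_zero, h, hp.map_zero]; norm_num
  have hd := differentiableOn_cosTransform hp.diff
  have hpd := hp.diff
  have h1 := eq_of_re_nonneg_of_re_eq_zero isOpen_ball isConnected_unitDisk
    (G := fun z => p z + ((-1 : ℝ) : ℂ) * cosTransform p z)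
    (by fun_prop) (fun w hw => hp.re_add_cosTransform_nonneg (by norm_num) hw) zero_mem_unitDisk
    (by rw [h0]; rfl) hz
  rw [h0] at h1
  have h2 := two_mul_cosTransform hp.map_zero z
  have h3 : 1 - z ≠ 0 := one_sub_ne_zero (mem_unitDisk.1 hz)
  rw [eq_div_iff h3]
  push_cast at h1
  have h4 : (1 - z) * (p z * (1 - z) - (1 + z)) = 0 := by
    linear_combination -h2 - 2 * z * h1
  rcases mul_eq_zero.1 h4 with h | h
  · exact absurd h h3
  · linear_combination h

lemma IsCaratheodory.eqOn_herglotzKernel {p : ℂ → ℂ} (hp : IsCaratheodory p) {η : ℂ}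
    (hη : ‖η‖ = 1) (h : deriv p 0 = 2 * η) : EqOn p (herglotzKernel η) unitDisk := by
  intro z hz
  have hη' : ‖conj η‖ = 1 := by rwa [RCLike.norm_conj]
  have hm := mul_conj_eq_one hη
  have h1 := (hp.rotate hη').eq_of_deriv_eq_two (by
    rw [deriv_comp_mul_left, mul_zero, smul_eq_mul, h]; linear_combination 2 * hm)
    (mem_unitDisk.2 (norm_mul_lt_one hη hz))
  rwa [← mul_assoc, mul_comm (conj η), hm, one_mul] at h1

lemma deriv_herglotzKernel (η : ℂ) : deriv (herglotzKernel η) 0 = 2 * η := by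
  have h1 : HasDerivAt (fun z : ℂ => η * z) η 0 := by
    simpa using (hasDerivAt_id (0 : ℂ)).const_mul η
  have h2 : HasDerivAt (fun z : ℂ => (1 + η * z) / (1 - η * z)) _ 0 :=
    (h1.const_add 1).div (h1.const_sub 1) (by simp)
  have h3 := h2.deriv
  unfold herglotzKernel
  rw [h3]
  simp
  ring

/-- The Herglotz kernels are extreme points of the Carathéodory class. -/
lemma eqOn_herglotzKernel_of_lin_comb {p₁ p₂ : ℂ → ℂ} (h₁ : IsCaratheodory p₁)
    (h₂ : IsCaratheodory p₂) {a b : ℝ} (ha : 0 < a) (hb : 0 < b) (hab : a + b = 1) {η : ℂ}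
    (hη : ‖η‖ = 1) (h : EqOn (herglotzKernel η) (fun z => a * p₁ z + b * p₂ z) unitDisk) :
    EqOn p₁ (herglotzKernel η) unitDisk := by
  refine h₁.eqOn_herglotzKernel hη ?_
  have hd1 := h₁.diff.differentiableAt (isOpen_ball.mem_nhds zero_mem_unitDisk)
  have hd2 := h₂.diff.differentiableAt (isOpen_ball.mem_nhds zero_mem_unitDisk)
  have e1 := (h.eventuallyEq_of_mem (isOpen_ball.mem_nhds zero_mem_unitDisk)).deriv_eq
  rw [deriv_herglotzKernel,
    ((hd1.hasDerivAt.const_mul (a : ℂ)).fun_add (hd2.hasDerivAt.const_mul (b : ℂ))).deriv] at e1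
  -- `2 * η` is an extreme point of the disk of radius `2`
  set x := conj η * deriv p₁ 0 with hx
  set y := conj η * deriv p₂ 0 with hy
  have hη' : ‖conj η‖ = 1 := by rwa [RCLike.norm_conj]
  have hm := mul_conj_eq_one hη
  have hx2 : ‖x‖ ≤ 2 := by rw [hx, norm_mul, hη', one_mul]; exact h₁.norm_deriv_le
  have hy2 : ‖y‖ ≤ 2 := by rw [hy, norm_mul, hη', one_mul]; exact h₂.norm_deriv_le
  have e2 : (2 : ℂ) = a * x + b * y := by linear_combination conj η * e1 - 2 * hm
  have e3 : 2 = a * x.re + b * y.re := by simpa using congrArg Complex.re e2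
  have hxr := Complex.re_le_norm x
  have hyr := Complex.re_le_norm y
  have hx3 : x.re = 2 := by
    refine le_antisymm (hxr.trans hx2) ?_
    nlinarith
  have hx4 : x.im = 0 := by
    have := Complex.sq_norm x
    rw [Complex.normSq_apply, hx3] at this
    nlinarith [norm_nonneg x]
  have hx5 : x = 2 := Complex.ext hx3 hx4
  linear_combination η * hx5 - η * hx - deriv p₁ 0 * hm

/-- `p` is not a proper convex combination of different functions of the Carathéodory class. -/
def IsExtremeCaratheodory (p : ℂ → ℂ) : Prop :=
  IsCaratheodory p ∧ ∀ p₁ p₂ : ℂ → ℂ, IsCaratheodory p₁ → IsCaratheodory p₂ →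
    ∀ a b : ℝ, 0 < a → 0 < b → a + b = 1 → EqOn p (fun z => a * p₁ z + b * p₂ z) unitDisk →
      EqOn p₁ p unitDisk

lemma IsExtremeCaratheodory.rotate {p : ℂ → ℂ} (hp : IsExtremeCaratheodory p) {η : ℂ}
    (hη : ‖η‖ = 1) : IsExtremeCaratheodory (fun z => p (η * z)) := by
  have hη' : ‖conj η‖ = 1 := by rwa [RCLike.norm_conj]
  have hm := mul_conj_eq_one hη
  refine ⟨hp.1.rotate hη, fun p₁ p₂ h₁ h₂ a b ha hb hab h z hz => ?_⟩
  have h3 := hp.2 _ _ (h₁.rotate hη') (h₂.rotate hη') a b ha hb hab (fun w hw => by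
    have := h (mem_unitDisk.2 (norm_mul_lt_one hη' hw))
    simpa only [← mul_assoc, hm, one_mul] using this)
  have h4 : p₁ (conj η * (η * z)) = p (η * z) := h3 (mem_unitDisk.2 (norm_mul_lt_one hη hz))
  rwa [show conj η * (η * z) = z by linear_combination z * hm] at h4

/-- An extreme point of the Carathéodory class with purely imaginary first coefficient: its
Herglotz measure is invariant under multiplication with `1 ± cos θ`, so it is carried by the zeros
of `cos θ`. -/
lemma IsExtremeCaratheodory.exists_of_deriv_imaginary {p : ℂ → ℂ} (hp : IsExtremeCaratheodory p)
    {κ : ℝ} (hκ : deriv p 0 = 2 * κ * Complex.I) :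
    ∃ η : ℂ, ‖η‖ = 1 ∧ EqOn p (herglotzKernel η) unitDisk := by
  have hI : ‖-Complex.I‖ = 1 := by simp
  have hC := hp.1
  have hd := differentiableOn_cosTransform hC.diff
  have hpd := hC.diff
  have hmem : ∀ s : ℝ, |s| ≤ 1 →
      IsCaratheodory (fun z => p z + s * cosTransform p z - s * κ * Complex.I) := fun s hs =>
    ⟨by fun_prop, by rw [cosTransform_zero, hκ, hC.map_zero]; ring,
      fun z hz => by simpa using hC.re_add_cosTransform_nonneg hs hz⟩
  have h1 := hp.2 _ _ (hmem 1 (by norm_num)) (hmem (-1) (by norm_num)) (1 / 2) (1 / 2)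
    (by norm_num) (by norm_num) (by norm_num) (fun z _ => by push_cast; ring)
  have h2 : ∀ z ∈ unitDisk,
      (1 + z ^ 2) * p z = 1 - z ^ 2 + 2 * (κ * Complex.I) * z := fun z hz => by
    have e1 : p z + ((1 : ℝ) : ℂ) * cosTransform p z - ((1 : ℝ) : ℂ) * κ * Complex.I = p z := h1 hz
    have e2 := two_mul_cosTransform hC.map_zero z
    push_cast at e1
    linear_combination -e2 + 2 * z * e1
  have hne : ∀ z ∈ unitDisk, 1 + z ^ 2 ≠ 0 := fun z hz h => by
    have : ‖z ^ 2‖ = 1 := by rw [eq_neg_of_add_eq_zero_right h, norm_neg, norm_one]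
    rw [norm_pow] at this
    nlinarith [mem_unitDisk.1 hz, norm_nonneg z]
  have hI2 := Complex.I_sq
  -- `p` is a convex combination of two kernels
  have h3 : EqOn p (fun z => ((1 + κ) / 2 : ℝ) * herglotzKernel Complex.I z
      + ((1 - κ) / 2 : ℝ) * herglotzKernel (-Complex.I) z) unitDisk := fun z hz => by
    have n1 : 1 - Complex.I * z ≠ 0 := one_sub_ne_zero (norm_mul_lt_one (by simp) hz)
    have n2 : 1 - -Complex.I * z ≠ 0 := one_sub_ne_zero (norm_mul_lt_one (by simp) hz)
    have e1 := h2 z hz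
    refine mul_left_cancel₀ (hne z hz) (e1.trans ?_)
    have e2 : (1 + z ^ 2) * herglotzKernel Complex.I z = (1 + Complex.I * z) ^ 2 := by
      rw [herglotzKernel, mul_div_assoc', div_eq_iff n1]
      linear_combination (1 + Complex.I * z) * z ^ 2 * hI2
    have e3 : (1 + z ^ 2) * herglotzKernel (-Complex.I) z = (1 - Complex.I * z) ^ 2 := by
      rw [herglotzKernel, mul_div_assoc', div_eq_iff n2]
      linear_combination (1 - Complex.I * z) * z ^ 2 * hI2
    push_cast
    linear_combination -((1 + κ) / 2 : ℂ) * e2 - ((1 - κ) / 2 : ℂ) * e3 - z ^ 2 * hI2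
  have hκ1 : |κ| ≤ 1 := by
    have := hC.norm_deriv_le
    rw [hκ] at this
    simp at this
    linarith
  obtain ⟨hk1, hk2⟩ := abs_le.1 hκ1
  have hJ : ‖Complex.I‖ = 1 := Complex.norm_I
  rcases hk1.eq_or_lt with h | h
  · refine ⟨-Complex.I, hI, fun z hz => ?_⟩
    rw [h3 hz, ← h]; norm_num
  · rcases hk2.eq_or_lt with h' | h'
    · refine ⟨Complex.I, hJ, fun z hz => ?_⟩
      rw [h3 hz, h']; norm_num
    · exact ⟨Complex.I, hJ, (hp.2 _ _ (isCaratheodory_herglotzKernel hJ)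
        (isCaratheodory_herglotzKernel hI) _ _ (by linarith) (by linarith) (by ring) h3).symm⟩

lemma IsExtremeCaratheodory.exists_eqOn_herglotzKernel {p : ℂ → ℂ}
    (hp : IsExtremeCaratheodory p) :
    ∃ η : ℂ, ‖η‖ = 1 ∧ EqOn p (herglotzKernel η) unitDisk := by
  obtain ⟨η, hη, h⟩ := exists_unit_mul_eq_norm (deriv p 0)
  have hη2 : ‖Complex.I * η‖ = 1 := by rw [norm_mul, Complex.norm_I, hη, one_mul]
  obtain ⟨ξ, hξ, h1⟩ := (hp.rotate hη2).exists_of_deriv_imaginary (κ := ‖deriv p 0‖ / 2) (by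
    rw [deriv_comp_mul_left, mul_zero, smul_eq_mul, mul_assoc, h]; push_cast; ring)
  have hm := mul_conj_eq_one hη2
  have hη' : ‖conj (Complex.I * η)‖ = 1 := by rwa [RCLike.norm_conj]
  refine ⟨ξ * conj (Complex.I * η), by rw [norm_mul, hξ, hη', one_mul], fun z hz => ?_⟩
  have h2 : p (Complex.I * η * (conj (Complex.I * η) * z)) =
      herglotzKernel ξ (conj (Complex.I * η) * z) := h1 (mem_unitDisk.2 (norm_mul_lt_one hη' hz))
  rw [show Complex.I * η * (conj (Complex.I * η) * z) = z by linear_combination z * hm] at h2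
  rw [h2, herglotzKernel, herglotzKernel, mul_assoc]

/-! ### The cone of typically real analytic functions -/

/-- The cone of analytic functions on the unit disk with `F 0 = 0` which are real on the real axis
and satisfy `Im z * Im (F z) ≥ 0`. The functions of this cone with `F' 0 = 1` are the classical
typically real functions. -/
structure IsTypicallyReal (F : ℂ → ℂ) : Prop where
  diff : DifferentiableOn ℂ F unitDisk
  map_zero : F 0 = 0
  im_eq_zero : ∀ z ∈ unitDisk, z.im = 0 → (F z).im = 0
  im_nonneg : ∀ z ∈ unitDisk, 0 ≤ z.im * (F z).im

lemma IsTypicallyReal.im_dilation_nonneg {F : ℂ → ℂ} (hF : IsTypicallyReal F) {ρ : ℝ}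
    (hρ : ρ ∈ Ioo (0 : ℝ) 1) {z : ℂ} (hz : ‖z‖ ≤ 1) : 0 ≤ z.im * (F (ρ * z)).im := by
  have h := hF.im_nonneg _ (dilation_mem hz hρ)
  rw [Complex.im_ofReal_mul, mul_assoc] at h
  exact nonneg_of_mul_nonneg_right h hρ.1

lemma two_re_mul_eq {z : ℂ} (hz : ‖z‖ = 1) : 2 * (z.re : ℂ) * z = z ^ 2 + 1 := by
  have h1 := mul_conj_eq_one hz
  have e1 : z + conj z = 2 * (z.re : ℂ) := by rw [Complex.add_conj]; push_cast; ring
  linear_combination -z * e1 + h1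

/-- On the unit circle, `(1 - z ^ 2) * (F z / z)` has real part `2 * Im z * Im (F z)`. -/
lemma IsTypicallyReal.re_nonneg {F : ℂ → ℂ} (hF : IsTypicallyReal F) {z : ℂ}
    (hz : z ∈ unitDisk) : 0 ≤ ((1 - z ^ 2) * dslope F 0 z).re := by
  have hD := differentiableOn_dslope_zero hF.diff
  refine re_nonneg_of_tendsto (G₁ := fun z => (1 - z ^ 2) * dslope F 0 z)
    (G := fun ρ z => (1 - z ^ 2) * (ρ * dslope F 0 (ρ * z))) ?_ ?_ hz ?_
  · intro ρ hρ
    have h2 := differentiableOn_dilation hD hρ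
    exact DifferentiableOn.mul (by fun_prop) (h2.const_mul _)
  · intro ρ hρ z hz
    have h1 := eq_add_mul_dslope F (ρ * z)
    rw [hF.map_zero] at h1
    have h2 := hF.im_dilation_nonneg hρ hz.le
    set W := F (ρ * z)
    set d := dslope F 0 (ρ * z)
    have h3 := mul_conj_eq_one hz
    have e2 : z - conj z = 2 * z.im * Complex.I := by rw [Complex.sub_conj]; push_cast; ring
    have h4 : (1 - z ^ 2) * (ρ * d) = ((2 * z.im : ℝ) : ℂ) * (-Complex.I * W) := by
      push_cast
      linear_combination -W * e2 - ρ * d * h3 + (z - conj z) * h1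
    rw [h4, Complex.re_ofReal_mul]
    simp
    nlinarith
  · have h2 := tendsto_dilation hD hz
    simpa using (tendsto_ofReal_one.mul h2).const_mul (1 - z ^ 2)

lemma IsTypicallyReal.deriv_re_nonneg {F : ℂ → ℂ} (hF : IsTypicallyReal F) :
    0 ≤ (deriv F 0).re := by
  simpa [dslope_same] using hF.re_nonneg zero_mem_unitDisk

lemma IsTypicallyReal.im_deriv {F : ℂ → ℂ} (hF : IsTypicallyReal F) : (deriv F 0).im = 0 := by
  simpa [dslope_same] using im_dslope_eq_zero hF.diff hF.im_eq_zero 0 zero_mem_unitDisk rfl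

lemma one_sub_sq_ne_zero {z : ℂ} (hz : z ∈ unitDisk) : 1 - z ^ 2 ≠ 0 := by
  refine one_sub_ne_zero ?_
  rw [norm_pow]
  nlinarith [mem_unitDisk.1 hz, norm_nonneg z]

lemma IsTypicallyReal.eq_zero_of_deriv_eq_zero {F : ℂ → ℂ} (hF : IsTypicallyReal F)
    (h : deriv F 0 = 0) {z : ℂ} (hz : z ∈ unitDisk) : F z = 0 := by
  have hD := differentiableOn_dslope_zero hF.diff
  have h1 := eq_of_re_nonneg_of_re_eq_zero isOpen_ball isConnected_unitDisk
    (G := fun z => (1 - z ^ 2) * dslope F 0 z)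
    (by fun_prop) (fun w hw => hF.re_nonneg hw) zero_mem_unitDisk (by simp [dslope_same, h]) hz
  simp only [dslope_same, h, mul_zero] at h1
  rw [eq_add_mul_dslope F z, (mul_eq_zero.1 h1).resolve_left (one_sub_sq_ne_zero hz), hF.map_zero]
  simp

lemma IsTypicallyReal.isCaratheodory {F : ℂ → ℂ} (hF : IsTypicallyReal F) (h : deriv F 0 = 1) :
    IsCaratheodory (fun z => (1 - z ^ 2) * dslope F 0 z) where
  diff := by
    have hD := differentiableOn_dslope_zero hF.diff
    fun_prop
  map_zero := by simp [dslope_same, h]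
  re_nonneg z hz := hF.re_nonneg hz

lemma IsTypicallyReal.norm_le {F : ℂ → ℂ} (hF : IsTypicallyReal F) (h : deriv F 0 = 1) {z : ℂ}
    {r : ℝ} (hr : r < 1) (hz : ‖z‖ ≤ r) : ‖F z‖ ≤ (3 / (1 - r) + 1) / (1 - r) := by
  have h1 := (hF.isCaratheodory h).norm_le hr hz
  have h0 := norm_nonneg z
  rw [norm_mul] at h1
  have h2 : 1 - r ≤ ‖1 - z ^ 2‖ := by
    have := norm_sub_norm_le (1 : ℂ) (z ^ 2)
    rw [norm_one, norm_pow] at this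
    nlinarith
  rw [eq_add_mul_dslope F z, hF.map_zero, zero_add, norm_mul, le_div_iff₀ (by linarith)]
  have h3 := norm_nonneg (dslope F 0 z)
  calc ‖z‖ * ‖dslope F 0 z‖ * (1 - r) ≤ 1 * ‖dslope F 0 z‖ * ‖1 - z ^ 2‖ := by
        gcongr
        linarith
    _ ≤ _ := by linarith

lemma deriv_mul_self_zero {g : ℂ → ℂ} (hg : DifferentiableOn ℂ g unitDisk) :
    deriv (fun z => z * g z) 0 = g 0 := by
  have h := (hg.differentiableAt (isOpen_ball.mem_nhds zero_mem_unitDisk)).hasDerivAt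
  simpa using ((hasDerivAt_id (0 : ℂ)).fun_mul h).deriv

/-- If `F` is a superposition of the kernels `robertsonKernel t` with respect to a measure `μ`,
this is the superposition with respect to the measure `t dμ`. Away from the origin it
equals `((z + 1/z) * F z - F' 0) / 2`, see `two_mul_cosShift`. -/
noncomputable def cosShift (F : ℂ → ℂ) (z : ℂ) : ℂ := z * ((F z + dslope (dslope F 0) 0 z) / 2)

lemma two_mul_cosShift {F : ℂ → ℂ} (hF : F 0 = 0) (z : ℂ) :
    2 * z * cosShift F z = (1 + z ^ 2) * F z - deriv F 0 * z := by
  have h1 := eq_add_mul_dslope F z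
  have h2 := eq_add_mul_dslope (dslope F 0) z
  rw [hF] at h1
  rw [dslope_same] at h2
  unfold cosShift
  linear_combination -h1 - z * h2

lemma differentiableOn_cosShift {F : ℂ → ℂ} (hF : DifferentiableOn ℂ F unitDisk) :
    DifferentiableOn ℂ (cosShift F) unitDisk := by
  have := differentiableOn_dslope_zero (differentiableOn_dslope_zero hF)
  unfold cosShift
  fun_prop

lemma deriv_cosShift {F : ℂ → ℂ} (hF : DifferentiableOn ℂ F unitDisk) (h0 : F 0 = 0) :
    deriv (cosShift F) 0 = deriv (dslope F 0) 0 / 2 := by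
  have := differentiableOn_dslope_zero (differentiableOn_dslope_zero hF)
  have h := deriv_mul_self_zero (g := fun z => (F z + dslope (dslope F 0) 0 z) / 2) (by fun_prop)
  simp only [h0, dslope_same, zero_add] at h
  exact h

/-- On the unit circle, `F + s * cosShift F` has imaginary part `(1 + s cos θ) * Im F`. -/
lemma IsTypicallyReal.add_cosShift {F : ℂ → ℂ} (hF : IsTypicallyReal F) {s : ℝ} (hs : |s| ≤ 1) :
    IsTypicallyReal (fun z => F z + s * cosShift F z) := by
  have hD1 := differentiableOn_dslope_zero hF.diff
  have hD2 := differentiableOn_dslope_zero hD1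
  have hr1 := im_dslope_eq_zero hF.diff hF.im_eq_zero
  have hr2 := im_dslope_eq_zero hD1 hr1
  have hd := differentiableOn_cosShift hF.diff
  have hFd := hF.diff
  refine ⟨by fun_prop, by simp [cosShift, hF.map_zero], fun z hz hi => ?_, fun z hz => ?_⟩
  · have h1 := hF.im_eq_zero z hz hi
    have h2 := hr2 z hz hi
    unfold cosShift
    rw [← Complex.conj_eq_iff_im] at *
    simp only [map_mul, map_add, map_div₀, hi, h1, h2, Complex.conj_ofReal, map_ofNat]
  refine im_mul_im_nonneg_of_tendsto (G₁ := fun z => F z + s * cosShift F z)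
    (G := fun ρ z => F (ρ * z) + s * (z * ((F (ρ * z) + ρ ^ 2 * dslope (dslope F 0) 0 (ρ * z)) / 2)))
    ?_ ?_ ?_ hz ?_
  · intro ρ hρ
    have h1 := differentiableOn_dilation hF.diff hρ
    have h2 := differentiableOn_dilation hD2 hρ
    exact h1.add ((differentiableOn_id.mul ((h1.add (h2.const_mul _)).div_const 2)).const_mul _)
  · intro ρ hρ z hz hi
    have hm := dilation_mem (mem_closedBall_zero_iff.1 hz) hρ
    have hi' : ((ρ : ℂ) * z).im = 0 := by rw [Complex.im_ofReal_mul, hi, mul_zero]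
    have h1 := hF.im_eq_zero _ hm hi'
    have h2 := hr2 _ hm hi'
    rw [← Complex.conj_eq_iff_im] at *
    simp only [map_mul, map_add, map_div₀, map_pow, hi, h1, h2, Complex.conj_ofReal, map_ofNat]
  · intro ρ hρ z hz
    have hc := hF.im_deriv
    have k1 := eq_add_mul_dslope F (ρ * z)
    have k2 := eq_add_mul_dslope (dslope F 0) (ρ * z)
    rw [hF.map_zero] at k1
    rw [dslope_same] at k2
    have h2 := hF.im_dilation_nonneg hρ hz.le
    set W := F (ρ * z)
    set a₁ := dslope F 0 (ρ * z)
    set a₂ := dslope (dslope F 0) 0 (ρ * z)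
    set c := deriv F 0
    have hx := two_re_mul_eq hz
    have hz0 : z ≠ 0 := by rintro rfl; simp at hz
    have h4 : W + s * (z * ((W + ρ ^ 2 * a₂) / 2)) =
        ((1 + s * z.re : ℝ) : ℂ) * W - ((s * ρ / 2 : ℝ) : ℂ) * c := by
      refine mul_left_cancel₀ hz0 ?_
      push_cast
      linear_combination (-s * W / 2) * hx - (s / 2) * k1 - (s * ρ * z / 2) * k2
    rw [h4, Complex.sub_im, Complex.im_ofReal_mul, Complex.im_ofReal_mul, hc, mul_zero, sub_zero]
    have h5 : |z.re| ≤ 1 := (Complex.abs_re_le_norm z).trans hz.le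
    have h6 : |s * z.re| ≤ 1 := by
      rw [abs_mul]; exact mul_le_one₀ hs (abs_nonneg _) h5
    have h7 : 0 ≤ 1 + s * z.re := by linarith [(abs_le.1 h6).1]
    calc 0 ≤ (1 + s * z.re) * (z.im * W.im) := mul_nonneg h7 h2
      _ = _ := by ring
  · have h1 := tendsto_dilation hF.diff hz
    have h2 := tendsto_dilation hD2 hz
    have h3 := tendsto_ofReal_one
    have h4 := h1.add ((((h1.add ((h3.pow 2).mul h2)).div_const 2).const_mul z).const_mul (s : ℂ))
    simpa [cosShift] using h4

/-- If `F` is a superposition of the kernels `robertsonKernel t` with respect to a measure `μ`,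
this is the superposition with respect to the measure `(t - s) ^ 2 dμ`. -/
noncomputable def sqShift (s : ℝ) (F : ℂ → ℂ) (z : ℂ) : ℂ :=
  z * ((z * F z + z * dslope (dslope F 0) 0 z + dslope F 0 z
    + dslope (dslope (dslope F 0) 0) 0 z) / 4
    - s * (F z + dslope (dslope F 0) 0 z) + s ^ 2 * dslope F 0 z)

/-- The algebraic identity behind `sqShift`: here `W`, `a₁`, `a₂`, `a₃` are the values at `z` of a
function vanishing at the origin and of its first three iterated difference quotients. -/
lemma sqShift_identity {z s W a₁ a₂ a₃ c d : ℂ} (k1 : W = z * a₁) (k2 : a₁ = c + z * a₂)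
    (k3 : a₂ = d + z * a₃) :
    4 * z ^ 2 * (z * ((z * W + z * a₂ + a₁ + a₃) / 4 - s * (W + a₂) + s ^ 2 * a₁)) =
      (1 + z ^ 2 - 2 * s * z) ^ 2 * W - c * z * (1 + z ^ 2) - d * z ^ 2 + 4 * s * c * z ^ 2 := by
  linear_combination -(1 + 2 * z ^ 2 - 4 * s * z + 4 * s ^ 2 * z ^ 2) * k1
    - (z + z ^ 3 - 4 * s * z ^ 2) * k2 - z ^ 2 * k3

/-- On the unit circle, `sqShift s F` has imaginary part `(cos θ - s) ^ 2 * Im F`. -/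
lemma IsTypicallyReal.isTypicallyReal_sqShift {F : ℂ → ℂ} (hF : IsTypicallyReal F) (s : ℝ) :
    IsTypicallyReal (sqShift s F) := by
  have hD1 := differentiableOn_dslope_zero hF.diff
  have hD2 := differentiableOn_dslope_zero hD1
  have hD3 := differentiableOn_dslope_zero hD2
  have hr1 := im_dslope_eq_zero hF.diff hF.im_eq_zero
  have hr2 := im_dslope_eq_zero hD1 hr1
  have hr3 := im_dslope_eq_zero hD2 hr2
  have hFd := hF.diff
  refine ⟨by unfold sqShift; fun_prop, by simp [sqShift], fun z hz hi => ?_,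
    fun z hz => ?_⟩
  · have h1 := hF.im_eq_zero z hz hi
    have h2 := hr1 z hz hi
    have h3 := hr2 z hz hi
    have h4 := hr3 z hz hi
    unfold sqShift
    rw [← Complex.conj_eq_iff_im] at *
    simp only [map_mul, map_add, map_sub, map_pow, map_div₀, hi, h1, h2, h3, h4,
      Complex.conj_ofReal, map_ofNat]
  refine im_mul_im_nonneg_of_tendsto (G₁ := sqShift s F)
    (G := fun ρ z => z * ((z * F (ρ * z) + z * (ρ ^ 2 * dslope (dslope F 0) 0 (ρ * z))
      + ρ * dslope F 0 (ρ * z) + ρ ^ 3 * dslope (dslope (dslope F 0) 0) 0 (ρ * z)) / 4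
      - s * (F (ρ * z) + ρ ^ 2 * dslope (dslope F 0) 0 (ρ * z))
      + s ^ 2 * (ρ * dslope F 0 (ρ * z))))
    ?_ ?_ ?_ hz ?_
  · intro ρ hρ
    have h0 := differentiableOn_dilation hF.diff hρ
    have h1 := (differentiableOn_dilation hD1 hρ).const_mul (ρ : ℂ)
    have h2 := (differentiableOn_dilation hD2 hρ).const_mul ((ρ : ℂ) ^ 2)
    have h3 := (differentiableOn_dilation hD3 hρ).const_mul ((ρ : ℂ) ^ 3)
    have hz : DifferentiableOn ℂ (fun z : ℂ => z) (closedBall 0 1) := differentiableOn_id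
    exact hz.mul (((((((hz.mul h0).add (hz.mul h2)).add h1).add h3).div_const 4).sub
      ((h0.add h2).const_mul (s : ℂ))).add (h1.const_mul ((s : ℂ) ^ 2)))
  · intro ρ hρ z hz hi
    have hm := dilation_mem (mem_closedBall_zero_iff.1 hz) hρ
    have hi' : ((ρ : ℂ) * z).im = 0 := by rw [Complex.im_ofReal_mul, hi, mul_zero]
    have h1 := hF.im_eq_zero _ hm hi'
    have h2 := hr1 _ hm hi'
    have h3 := hr2 _ hm hi'
    have h4 := hr3 _ hm hi'
    rw [← Complex.conj_eq_iff_im] at *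
    simp only [map_mul, map_add, map_sub, map_div₀, map_pow, hi, h1, h2, h3, h4,
      Complex.conj_ofReal, map_ofNat]
  · intro ρ hρ z hz
    have hc := hF.im_deriv
    have hd := hr2 0 zero_mem_unitDisk rfl
    rw [dslope_same] at hd
    have k1 := eq_add_mul_dslope F (ρ * z)
    have k2 := eq_add_mul_dslope (dslope F 0) (ρ * z)
    have k3 := eq_add_mul_dslope (dslope (dslope F 0) 0) (ρ * z)
    rw [hF.map_zero] at k1
    rw [dslope_same] at k2 k3
    have h2 := hF.im_dilation_nonneg hρ hz.le
    set W := F (ρ * z)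
    set a₁ := dslope F 0 (ρ * z)
    set a₂ := dslope (dslope F 0) 0 (ρ * z)
    set a₃ := dslope (dslope (dslope F 0) 0) 0 (ρ * z)
    set c := deriv F 0
    set d := deriv (dslope F 0) 0
    have hx := two_re_mul_eq hz
    have hz0 : z ≠ 0 := by rintro rfl; simp at hz
    have h4 := sqShift_identity (s := (s : ℂ)) (z := z) (W := W) (a₁ := ρ * a₁)
      (a₂ := ρ ^ 2 * a₂) (a₃ := ρ ^ 3 * a₃) (c := ρ * c) (d := ρ ^ 2 * d)
      (by linear_combination k1) (by linear_combination ρ * k2) (by linear_combination ρ ^ 2 * k3)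
    have h5 : z * ((z * W + z * (ρ ^ 2 * a₂) + ρ * a₁ + ρ ^ 3 * a₃) / 4 - s * (W + ρ ^ 2 * a₂)
        + s ^ 2 * (ρ * a₁)) = (((z.re - s) ^ 2 : ℝ) : ℂ) * W - ((z.re * ρ / 2 - s * ρ : ℝ) : ℂ) * c
        - ((ρ ^ 2 / 4 : ℝ) : ℂ) * d := by
      refine mul_left_cancel₀ (by simpa using hz0 : 4 * z ^ 2 ≠ 0) (h4.trans ?_)
      push_cast
      linear_combination (-(z ^ 2 + 1 - 2 * s * z + 2 * z.re * z - 2 * s * z) * W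
        + ρ * c * z) * hx
    rw [h5, Complex.sub_im, Complex.sub_im, Complex.im_ofReal_mul, Complex.im_ofReal_mul,
      Complex.im_ofReal_mul, hc, hd, mul_zero, mul_zero, sub_zero, sub_zero]
    calc 0 ≤ (z.re - s) ^ 2 * (z.im * W.im) := mul_nonneg (sq_nonneg _) h2
      _ = _ := by ring
  · have h0 := tendsto_dilation hF.diff hz
    have h1 := tendsto_dilation hD1 hz
    have h2 := tendsto_dilation hD2 hz
    have h3 := tendsto_dilation hD3 hz
    have hρ := tendsto_ofReal_one
    have g1 := hρ.mul h1
    have g2 := (hρ.pow 2).mul h2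
    have g3 := (hρ.pow 3).mul h3
    have h4 := (((((((h0.const_mul z).add (g2.const_mul z)).add g1).add g3).div_const 4).sub
      ((h0.add g2).const_mul (s : ℂ))).add (g1.const_mul ((s : ℂ) ^ 2))).const_mul z
    simpa [sqShift] using h4

lemma deriv_sqShift {F : ℂ → ℂ} (hF : DifferentiableOn ℂ F unitDisk) (h0 : F 0 = 0) (s : ℝ) :
    deriv (sqShift s F) 0 = (deriv F 0 + deriv (dslope (dslope F 0) 0) 0) / 4
      - s * deriv (dslope F 0) 0 + s ^ 2 * deriv F 0 := by
  have hD1 := differentiableOn_dslope_zero hF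
  have hD2 := differentiableOn_dslope_zero hD1
  have hD3 := differentiableOn_dslope_zero hD2
  have h := deriv_mul_self_zero (g := fun z => (z * F z + z * dslope (dslope F 0) 0 z
    + dslope F 0 z + dslope (dslope (dslope F 0) 0) 0 z) / 4
    - s * (F z + dslope (dslope F 0) 0 z) + s ^ 2 * dslope F 0 z) (by fun_prop)
  refine Eq.trans h ?_
  simp [h0, dslope_same]

/-! ### The kernels `z / (1 - 2 t z + z ^ 2)` -/

lemma robertson_denom_mul (t : ℝ) (z : ℂ) : (z * conj (1 - 2 * (t : ℂ) * z + z ^ 2)).im =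
    z.im * (1 - Complex.normSq z) := by
  simp [Complex.normSq_apply, pow_two]
  ring

lemma robertson_denom_ne_zero {t : ℝ} (ht : t ∈ Icc (-1 : ℝ) 1) {z : ℂ} (hz : z ∈ unitDisk) :
    1 - 2 * (t : ℂ) * z + z ^ 2 ≠ 0 := by
  intro h
  have h1 := robertson_denom_mul t z
  have hn : Complex.normSq z < 1 := by
    rw [Complex.normSq_eq_norm_sq]
    nlinarith [mem_unitDisk.1 hz, norm_nonneg z]
  rw [h, map_zero, mul_zero, Complex.zero_im] at h1
  have h2 : z.im = 0 := (mul_eq_zero.1 h1.symm).resolve_right (by linarith)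
  have h3 := congrArg Complex.re h
  simp [pow_two, h2] at h3
  rw [Complex.normSq_apply, h2] at hn
  obtain ⟨ht1, ht2⟩ := ht
  nlinarith [sq_nonneg (z.re - t), sq_nonneg (z.re + t), sq_nonneg (1 - z.re),
    sq_nonneg (1 + z.re), mul_nonneg (sub_nonneg.2 ht2) (sub_nonneg.2 ht1)]

lemma differentiableOn_robertsonKernel {t : ℝ} (ht : t ∈ Icc (-1 : ℝ) 1) :
    DifferentiableOn ℂ (robertsonKernel t) unitDisk := by
  unfold robertsonKernel
  exact DifferentiableOn.div (by fun_prop) (by fun_prop) fun z hz => robertson_denom_ne_zero ht hz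

lemma isTypicallyReal_robertsonKernel {t : ℝ} (ht : t ∈ Icc (-1 : ℝ) 1) :
    IsTypicallyReal (robertsonKernel t) := by
  have key : ∀ z : ℂ, (robertsonKernel t z).im =
      z.im * (1 - Complex.normSq z) / Complex.normSq (1 - 2 * (t : ℂ) * z + z ^ 2) := fun z => by
    rw [← robertson_denom_mul t z, robertsonKernel, div_eq_mul_inv, Complex.inv_def, ← mul_assoc,
      mul_comm, Complex.im_ofReal_mul, div_eq_inv_mul]
  refine ⟨differentiableOn_robertsonKernel ht, by simp [robertsonKernel], fun z hz hi => ?_,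
    fun z hz => ?_⟩
  · rw [key, hi]; simp
  · have hn : Complex.normSq z < 1 := by
      rw [Complex.normSq_eq_norm_sq]
      nlinarith [mem_unitDisk.1 hz, norm_nonneg z]
    rw [key, ← mul_div_assoc, ← mul_assoc]
    exact div_nonneg (mul_nonneg (mul_self_nonneg _) (by linarith)) (Complex.normSq_nonneg _)

lemma eqOn_dslope_of_eq_add_mul {F g : ℂ → ℂ} {c : ℂ} (hg : DifferentiableOn ℂ g unitDisk)
    (h : ∀ z ∈ unitDisk, F z = c + z * g z) : EqOn (dslope F 0) g unitDisk := by
  intro z hz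
  have h0 : F 0 = c := by simpa using h 0 zero_mem_unitDisk
  by_cases hz0 : z = 0
  · subst hz0
    have e : EqOn F (fun z => c + z * g z) unitDisk := h
    rw [dslope_same, (e.eventuallyEq_of_mem (isOpen_ball.mem_nhds hz)).deriv_eq, deriv_const_add,
      deriv_mul_self_zero hg]
  · have := eq_add_mul_dslope F z
    rw [h0, h z hz] at this
    exact (mul_left_cancel₀ hz0 (add_left_cancel this)).symm

lemma eqOn_dslope_robertsonKernel {t : ℝ} (ht : t ∈ Icc (-1 : ℝ) 1) :
    EqOn (dslope (robertsonKernel t) 0) (fun z => 1 / (1 - 2 * (t : ℂ) * z + z ^ 2)) unitDisk :=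
  eqOn_dslope_of_eq_add_mul (c := 0)
    (DifferentiableOn.div (by fun_prop) (by fun_prop) fun z hz => robertson_denom_ne_zero ht hz)
    fun z _ => by simp [robertsonKernel, div_eq_mul_inv]

lemma eqOn_dslope_dslope_robertsonKernel {t : ℝ} (ht : t ∈ Icc (-1 : ℝ) 1) :
    EqOn (dslope (dslope (robertsonKernel t) 0) 0)
      (fun z => (2 * t - z) / (1 - 2 * (t : ℂ) * z + z ^ 2)) unitDisk :=
  eqOn_dslope_of_eq_add_mul (c := 1)
    (DifferentiableOn.div (by fun_prop) (by fun_prop) fun z hz => robertson_denom_ne_zero ht hz)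
    fun z hz => by
      have := robertson_denom_ne_zero ht hz
      rw [eqOn_dslope_robertsonKernel ht hz]
      field_simp
      ring

lemma eqOn_dslope_dslope_dslope_robertsonKernel {t : ℝ} (ht : t ∈ Icc (-1 : ℝ) 1) :
    EqOn (dslope (dslope (dslope (robertsonKernel t) 0) 0) 0)
      (fun z => (4 * t ^ 2 - 1 - 2 * t * z) / (1 - 2 * (t : ℂ) * z + z ^ 2)) unitDisk :=
  eqOn_dslope_of_eq_add_mul (c := 2 * t)
    (DifferentiableOn.div (by fun_prop) (by fun_prop) fun z hz => robertson_denom_ne_zero ht hz)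
    fun z hz => by
      have := robertson_denom_ne_zero ht hz
      rw [eqOn_dslope_dslope_robertsonKernel ht hz]
      field_simp
      ring

lemma deriv_robertsonKernel_zero {t : ℝ} (ht : t ∈ Icc (-1 : ℝ) 1) :
    deriv (robertsonKernel t) 0 = 1 := by
  have := eqOn_dslope_robertsonKernel ht zero_mem_unitDisk
  simpa [dslope_same] using this

/-! ### Extreme points of the class of typically real functions -/

/-- For `F z = z + d z ^ 2 + e z ^ 3 + ⋯` typically real, `d ^ 2 - 1 ≤ e`. -/
lemma IsTypicallyReal.sq_coeff_le {F : ℂ → ℂ} (hF : IsTypicallyReal F) (h1 : deriv F 0 = 1) :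
    (deriv (dslope F 0) 0).re ^ 2 - 1 ≤ (deriv (dslope (dslope F 0) 0) 0).re := by
  -- the variance of the parameter `t` with respect to the representing measure is nonnegative
  set d := deriv (dslope F 0) 0 with hd
  have h := (hF.isTypicallyReal_sqShift (d.re / 2)).deriv_re_nonneg
  rw [deriv_sqShift hF.diff hF.map_zero, h1, ← hd] at h
  have h2 : ((d.re / 2 : ℝ) : ℂ) ^ 2 * 1 = (((d.re / 2) ^ 2 : ℝ) : ℂ) := by push_cast; ring
  rw [h2, Complex.add_re, Complex.sub_re, Complex.re_ofReal_mul, Complex.ofReal_re,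
    show (4 : ℂ) = ((4 : ℝ) : ℂ) by norm_num, Complex.div_ofReal_re, Complex.add_re,
    Complex.one_re] at h
  linarith

lemma IsTypicallyReal.eqOn_robertsonKernel_of_sq_coeff {F : ℂ → ℂ} (hF : IsTypicallyReal F)
    (h1 : deriv F 0 = 1) {t : ℝ} (ht : t ∈ Icc (-1 : ℝ) 1)
    (hd : deriv (dslope F 0) 0 = 2 * t)
    (he : deriv (dslope (dslope F 0) 0) 0 = 4 * t ^ 2 - 1) :
    EqOn F (robertsonKernel t) unitDisk := by
  intro z hz
  have h0 := (hF.isTypicallyReal_sqShift t).eq_zero_of_deriv_eq_zero (by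
    rw [deriv_sqShift hF.diff hF.map_zero, h1, hd, he]; ring) hz
  have k1 := eq_add_mul_dslope F z
  have k2 := eq_add_mul_dslope (dslope F 0) z
  have k3 := eq_add_mul_dslope (dslope (dslope F 0) 0) z
  rw [hF.map_zero, zero_add] at k1
  rw [dslope_same, h1] at k2
  rw [dslope_same, hd] at k3
  have h4 := sqShift_identity (s := (t : ℂ)) k1 k2 k3
  rw [sqShift] at h0
  rw [h0, mul_zero] at h4
  have hne := robertson_denom_ne_zero ht hz
  rw [robertsonKernel, eq_div_iff hne]
  refine mul_left_cancel₀ hne ?_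
  linear_combination -h4

/-- `F` is a typically real function with `F' 0 = 1` and not a proper convex combination of
different functions of this kind. -/
def IsExtremeTypicallyReal (F : ℂ → ℂ) : Prop :=
  (IsTypicallyReal F ∧ deriv F 0 = 1) ∧ ∀ F₁ F₂ : ℂ → ℂ, IsTypicallyReal F₁ → deriv F₁ 0 = 1 →
    IsTypicallyReal F₂ → deriv F₂ 0 = 1 → ∀ a b : ℝ, 0 < a → 0 < b → a + b = 1 →
      EqOn F (fun z => a * F₁ z + b * F₂ z) unitDisk → EqOn F₁ F unitDisk

lemma hasDerivAt_zero_of_diff {F : ℂ → ℂ} (hF : DifferentiableOn ℂ F unitDisk) :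
    HasDerivAt F (deriv F 0) 0 :=
  (hF.differentiableAt (isOpen_ball.mem_nhds zero_mem_unitDisk)).hasDerivAt

/-- The Robertson kernels are extreme points of the class of typically real functions: they lie on
the parabola `e = d ^ 2 - 1`, where `d` and `e` are the second and the third coefficient. -/
lemma eqOn_robertsonKernel_of_lin_comb {F₁ F₂ : ℂ → ℂ} (h₁ : IsTypicallyReal F₁)
    (h₁' : deriv F₁ 0 = 1) (h₂ : IsTypicallyReal F₂) (h₂' : deriv F₂ 0 = 1) {a b : ℝ} (ha : 0 < a)
    (hb : 0 < b) (hab : a + b = 1) {t : ℝ} (ht : t ∈ Icc (-1 : ℝ) 1)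
    (h : EqOn (robertsonKernel t) (fun z => a * F₁ z + b * F₂ z) unitDisk) :
    EqOn F₁ (robertsonKernel t) unitDisk := by
  have e1 : EqOn (dslope (robertsonKernel t) 0)
      (fun z => a * dslope F₁ 0 z + b * dslope F₂ 0 z) unitDisk := fun z hz => by
    rw [dslope_eq_on_disk h hz, dslope_lin_comb h₁.diff h₂.diff]
  have e2 : EqOn (dslope (dslope (robertsonKernel t) 0) 0)
      (fun z => a * dslope (dslope F₁ 0) 0 z + b * dslope (dslope F₂ 0) 0 z) unitDisk :=
    fun z hz => by
      rw [dslope_eq_on_disk e1 hz, dslope_lin_comb (differentiableOn_dslope_zero h₁.diff)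
        (differentiableOn_dslope_zero h₂.diff)]
  have e3 : EqOn (dslope (dslope (dslope (robertsonKernel t) 0) 0) 0)
      (fun z => a * dslope (dslope (dslope F₁ 0) 0) 0 z
        + b * dslope (dslope (dslope F₂ 0) 0) 0 z) unitDisk := fun z hz => by
    rw [dslope_eq_on_disk e2 hz,
      dslope_lin_comb (differentiableOn_dslope_zero (differentiableOn_dslope_zero h₁.diff))
        (differentiableOn_dslope_zero (differentiableOn_dslope_zero h₂.diff))]
  have f2 := (eqOn_dslope_dslope_robertsonKernel ht zero_mem_unitDisk).symm.trans
    (e2 zero_mem_unitDisk)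
  have f3 := (eqOn_dslope_dslope_dslope_robertsonKernel ht zero_mem_unitDisk).symm.trans
    (e3 zero_mem_unitDisk)
  simp only [dslope_same] at f2 f3
  have s₁ := h₁.sq_coeff_le h₁'
  have s₂ := h₂.sq_coeff_le h₂'
  have hr : ∀ {F : ℂ → ℂ}, IsTypicallyReal F → (deriv (dslope F 0) 0).im = 0 ∧
      (deriv (dslope (dslope F 0) 0) 0).im = 0 := fun {F} hF => by
    have hD1 := differentiableOn_dslope_zero hF.diff
    have hr1 := im_dslope_eq_zero hF.diff hF.im_eq_zero
    have hr2 := im_dslope_eq_zero hD1 hr1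
    have hr3 := im_dslope_eq_zero (differentiableOn_dslope_zero hD1) hr2
    exact ⟨by simpa [dslope_same] using hr2 0 zero_mem_unitDisk rfl,
      by simpa [dslope_same] using hr3 0 zero_mem_unitDisk rfl⟩
  obtain ⟨i₁, j₁⟩ := hr h₁
  set d₁ := deriv (dslope F₁ 0) 0
  set d₂ := deriv (dslope F₂ 0) 0
  set c₁ := deriv (dslope (dslope F₁ 0) 0) 0
  set c₂ := deriv (dslope (dslope F₂ 0) 0) 0
  have g2 : 2 * t = a * d₁.re + b * d₂.re := by
    simpa using congrArg Complex.re f2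
  have g3 : 4 * t ^ 2 - 1 = a * c₁.re + b * c₂.re := by
    have := congrArg Complex.re f3
    norm_num [← Complex.ofReal_pow] at this
    exact this
  -- equality in the convexity inequality for the square
  have hb' : b = 1 - a := by linarith
  have v1 : a * b * (d₁.re - d₂.re) ^ 2 ≤ 0 := by
    have : a * (d₁.re ^ 2 - 1) + b * (d₂.re ^ 2 - 1) ≤ 4 * t ^ 2 - 1 := by
      rw [g3]; gcongr
    have e : (2 * t) ^ 2 = (a * d₁.re + b * d₂.re) ^ 2 := by rw [g2]
    subst hb'
    nlinarith
  have v2 : d₁.re - d₂.re = 0 := by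
    have hp := mul_pos ha hb
    exact pow_eq_zero_iff two_ne_zero |>.1
      (le_antisymm (nonpos_of_mul_nonpos_right v1 hp) (sq_nonneg _))
  have v3 : d₁.re = 2 * t := by
    rw [g2, hb']; linear_combination (1 - a) * v2
  have v4 : d₂.re = 2 * t := by linarith
  have v5 : c₁.re = 4 * t ^ 2 - 1 := by
    rw [v3, mul_pow, show (2 : ℝ) ^ 2 = 4 by norm_num] at s₁
    rw [v4, mul_pow, show (2 : ℝ) ^ 2 = 4 by norm_num] at s₂
    refine le_antisymm ?_ s₁
    by_contra! hlt
    nlinarith [mul_lt_mul_of_pos_left hlt ha, mul_le_mul_of_nonneg_left s₂ hb.le]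
  refine h₁.eqOn_robertsonKernel_of_sq_coeff h₁' ht (Complex.ext ?_ ?_) (Complex.ext ?_ ?_)
  · simpa using v3
  · simpa using i₁
  · norm_num [← Complex.ofReal_pow]; exact v5
  · norm_num [← Complex.ofReal_pow]; exact j₁

lemma IsTypicallyReal.smul {F : ℂ → ℂ} (hF : IsTypicallyReal F) {c : ℝ} (hc : 0 ≤ c) :
    IsTypicallyReal (fun z => c * F z) := by
  refine ⟨hF.diff.const_mul _, by simp [hF.map_zero], fun z hz hi => ?_, fun z hz => ?_⟩
  · rw [Complex.im_ofReal_mul, hF.im_eq_zero z hz hi, mul_zero]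
  · rw [Complex.im_ofReal_mul]
    have := mul_nonneg hc (hF.im_nonneg z hz)
    linarith

/-- The representing measure of an extreme typically real function is invariant, up to a constant,
under multiplication with `1 ± t`, so it is a point mass. -/
lemma IsExtremeTypicallyReal.exists_eqOn_robertsonKernel {F : ℂ → ℂ}
    (hF : IsExtremeTypicallyReal F) :
    ∃ t ∈ Icc (-1 : ℝ) 1, EqOn F (robertsonKernel t) unitDisk := by
  obtain ⟨⟨hT, h1⟩, hext⟩ := hF
  have hD1 := differentiableOn_dslope_zero hT.diff
  have hi : (deriv (dslope F 0) 0).im = 0 := by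
    simpa [dslope_same] using
      im_dslope_eq_zero hD1 (im_dslope_eq_zero hT.diff hT.im_eq_zero) 0 zero_mem_unitDisk rfl
  obtain ⟨t, ht⟩ : ∃ t : ℝ, deriv (dslope F 0) 0 / 2 = t :=
    ⟨(deriv (dslope F 0) 0 / 2).re, Complex.ext (by simp) (by simp [hi])⟩
  have hcd : deriv (cosShift F) 0 = t := by rw [deriv_cosShift hT.diff hT.map_zero, ht]
  have hder : ∀ s : ℝ, deriv (fun z => F z + s * cosShift F z) 0 = ((1 + s * t : ℝ) : ℂ) :=
    fun s => by
      have := ((hasDerivAt_zero_of_diff hT.diff).fun_add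
        ((hasDerivAt_zero_of_diff (differentiableOn_cosShift hT.diff)).const_mul (s : ℂ))).deriv
      rw [this, h1, hcd]; push_cast; ring
  have hp := hT.add_cosShift (s := 1) (by norm_num)
  have hm := hT.add_cosShift (s := -1) (by norm_num)
  have hp1 : 0 ≤ 1 + t := by
    have h := hp.deriv_re_nonneg
    rwa [hder, Complex.ofReal_re, one_mul] at h
  have hm1 : t ≤ 1 := by
    have h := hm.deriv_re_nonneg
    rw [hder, Complex.ofReal_re] at h; linarith
  have ht' : t ∈ Icc (-1 : ℝ) 1 := ⟨by linarith, hm1⟩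
  refine ⟨t, ht', fun z hz => ?_⟩
  -- both in the extreme case `t = ± 1` and in the case of a proper convex combination
  have key : cosShift F z = t * F z := by
    rcases hp1.eq_or_lt with h | h
    · have e := hp.eq_zero_of_deriv_eq_zero (by rw [hder, one_mul, ← h, Complex.ofReal_zero]) hz
      have : t = -1 := by linarith
      rw [this]; push_cast at e ⊢
      linear_combination e
    rcases hm1.eq_or_lt with h' | h'
    · have e := hm.eq_zero_of_deriv_eq_zero (by rw [hder, h']; norm_num) hz
      rw [h']; push_cast at e ⊢
      linear_combination -e
    have n1 : ((1 + t : ℝ) : ℂ) ≠ 0 := Complex.ofReal_ne_zero.2 h.ne'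
    have n2 : ((1 - t : ℝ) : ℂ) ≠ 0 := Complex.ofReal_ne_zero.2 (by linarith)
    have e : (((1 + t)⁻¹ : ℝ) : ℂ) * (F z + ((1 : ℝ) : ℂ) * cosShift F z) = F z :=
      hext _ _ (hp.smul (c := (1 + t)⁻¹) (by positivity)) (by
          rw [deriv_const_mul_field, hder, one_mul, ← Complex.ofReal_mul, inv_mul_cancel₀ h.ne',
            Complex.ofReal_one])
        (hm.smul (c := (1 - t)⁻¹) (inv_nonneg.2 (by linarith))) (by
          rw [deriv_const_mul_field, hder, ← Complex.ofReal_mul, neg_one_mul, ← sub_eq_add_neg,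
            inv_mul_cancel₀ (by linarith), Complex.ofReal_one])
        ((1 + t) / 2) ((1 - t) / 2) (by linarith) (by linarith) (by ring)
        (fun w _ => by
          push_cast at n1 n2 ⊢
          field_simp
          ring) hz
    push_cast at e n1
    field_simp at e
    linear_combination e
  have h2 := two_mul_cosShift hT.map_zero z
  have hne := robertson_denom_ne_zero ht' hz
  rw [h1, key] at h2
  rw [robertsonKernel, eq_div_iff hne]
  linear_combination -h2

/-! ### Harmonic typically real functions as shears -/

/-- `f = Re H + i Im F` on the unit disk, where `H' = p F'`, `H 0 = 0`, `p` belongs to the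
Carathéodory class and `F` is a normalized typically real function. -/
structure IsShear (f : unitDisk → ℂ) (p F H : ℂ → ℂ) : Prop where
  isCaratheodory : IsCaratheodory p
  isTypicallyReal : IsTypicallyReal F
  deriv_zero : deriv F 0 = 1
  diff : DifferentiableOn ℂ H unitDisk
  map_zero : H 0 = 0
  deriv_eq : ∀ z ∈ unitDisk, deriv H z = p z * deriv F z
  eq : ∀ z : unitDisk, f z = ((H z).re : ℂ) + Complex.I * ((F z).im : ℂ)

lemma differentiableAt_of_mem {F : ℂ → ℂ} (hF : DifferentiableOn ℂ F unitDisk) {z : ℂ}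
    (hz : z ∈ unitDisk) : DifferentiableAt ℂ F z :=
  hF.differentiableAt (isOpen_ball.mem_nhds hz)

lemma ofReal_mem_unitDisk {x : ℝ} (h0 : 0 ≤ x) (h1 : x < 1) : (x : ℂ) ∈ unitDisk := by
  rwa [mem_unitDisk, Complex.norm_real, Real.norm_of_nonneg h0]

lemma exists_re_dslope_pos {F : ℂ → ℂ} (hF : DifferentiableOn ℂ F unitDisk)
    (h : 0 < (deriv F 0).re) :
    ∃ δ : ℝ, 0 < δ ∧ δ < 1 ∧ ∀ z : ℂ, ‖z‖ ≤ δ → 0 < (dslope F 0 z).re := by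
  have hc : ContinuousAt (fun z => (dslope F 0 z).re) 0 :=
    Complex.continuous_re.continuousAt.comp
      (differentiableAt_of_mem (differentiableOn_dslope_zero hF) zero_mem_unitDisk).continuousAt
  have h1 : ∀ᶠ z in 𝓝 (0 : ℂ), 0 < (dslope F 0 z).re :=
    hc.eventually (lt_mem_nhds (by simpa [dslope_same] using h))
  obtain ⟨ε, hε, h2⟩ := Metric.eventually_nhds_iff.1 h1
  refine ⟨min (ε / 2) (1 / 2), by positivity, (min_le_right _ _).trans_lt (by norm_num),
    fun z hz => h2 ?_⟩
  rw [dist_zero_right]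
  exact (hz.trans (min_le_left _ _)).trans_lt (by linarith)

lemma isOpen_upperHalfDisk : IsOpen (unitDisk ∩ {z : ℂ | 0 < z.im}) :=
  isOpen_ball.inter (isOpen_lt continuous_const Complex.continuous_im)

lemma isConnected_upperHalfDisk : IsConnected (unitDisk ∩ {z : ℂ | 0 < z.im}) := by
  refine ((convex_ball (0 : ℂ) 1).inter (convex_halfSpace_im_gt 0)).isConnected
    ⟨(1 / 2 : ℝ) * Complex.I, ?_, ?_⟩
  · rw [mem_unitDisk, norm_mul, Complex.norm_I, Complex.norm_real]; norm_num
  · simp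

/-- An analytic function which takes no real values off the real axis maps the upper half of the
disk to the upper half plane, if the derivative at the origin points to the right. -/
lemma im_pos_of_im_ne_zero {F : ℂ → ℂ} (hF : DifferentiableOn ℂ F unitDisk) (h0 : F 0 = 0)
    (hd : 0 < (deriv F 0).re) (h : ∀ z ∈ unitDisk, (F z).im = 0 → z.im = 0) {z : ℂ}
    (hz : z ∈ unitDisk) (hi : 0 < z.im) : 0 < (F z).im := by
  obtain ⟨δ, hδ0, hδ1, hδ⟩ := exists_re_dslope_pos hF hd
  have hn : ‖(δ : ℂ) * Complex.I‖ = δ := by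
    rw [norm_mul, Complex.norm_I, Complex.norm_real, Real.norm_of_nonneg hδ0.le, mul_one]
  have hm : (δ : ℂ) * Complex.I ∈ unitDisk ∩ {z : ℂ | 0 < z.im} :=
    ⟨mem_unitDisk.2 (by rw [hn]; exact hδ1), by simpa using hδ0⟩
  have hp : 0 < (F (δ * Complex.I)).im := by
    rw [eq_add_mul_dslope F, h0, zero_add, mul_assoc, Complex.im_ofReal_mul, Complex.I_mul_im]
    exact mul_pos hδ0 (hδ _ hn.le)
  by_contra! hneg
  have hc : ContinuousOn (fun z => (F z).im) (unitDisk ∩ {z : ℂ | 0 < z.im}) :=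
    Complex.continuous_im.comp_continuousOn (hF.continuousOn.mono inter_subset_left)
  obtain ⟨w, hw, hw0⟩ := isConnected_upperHalfDisk.isPreconnected.intermediate_value
    (a := z) ⟨hz, hi⟩ hm hc ⟨hneg, hp.le⟩
  exact (ne_of_gt (show 0 < w.im from hw.2)) (h w hw.1 hw0)

lemma im_mul_im_nonneg_of_im_ne_zero {F : ℂ → ℂ} (hF : DifferentiableOn ℂ F unitDisk)
    (h0 : F 0 = 0) (hd : 0 < (deriv F 0).re) (h : ∀ z ∈ unitDisk, (F z).im = 0 → z.im = 0) :
    ∀ z ∈ unitDisk, 0 ≤ z.im * (F z).im := by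
  intro z hz
  rcases lt_trichotomy z.im 0 with hi | hi | hi
  · have hF' : DifferentiableOn ℂ (fun w => -F (-w)) unitDisk :=
      (hF.comp (differentiableOn_neg _) fun w hw => by simpa using hw).neg
    have hd' : 0 < (deriv (fun w => -F (-w)) 0).re := by
      have : deriv (fun w => -F (-w)) 0 = deriv F 0 := by
        rw [deriv.fun_neg, deriv_comp_neg, neg_zero, neg_neg]
      rwa [this]
    have := im_pos_of_im_ne_zero hF' (by simp [h0]) hd'
      (fun w hw hw0 => by simpa using h (-w) (by simpa using hw) (by simpa using hw0))
      (z := -z) (by simpa using hz) (by simpa using hi)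
    simp only [neg_neg, Complex.neg_im] at this
    nlinarith
  · simp [hi]
  · exact mul_nonneg hi.le (im_pos_of_im_ne_zero hF h0 hd h hz hi).le

/-- Two analytic functions with the same imaginary part and the same value at `0` agree. -/
lemma eqOn_of_im_eq {F G : ℂ → ℂ} (hF : DifferentiableOn ℂ F unitDisk)
    (hG : DifferentiableOn ℂ G unitDisk) (h0 : F 0 = G 0)
    (h : ∀ z ∈ unitDisk, (F z).im = (G z).im) : EqOn F G unitDisk := by
  obtain ⟨c, hc⟩ := AnalyticOnNhd.eq_const_of_im_eq_const (c₀ := 0)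
    ((hF.sub hG).analyticOnNhd isOpen_ball) (fun z hz => by simp [h z hz]) isOpen_ball
    isConnected_unitDisk
  intro z hz
  have h1 := hc z hz
  have h2 := hc 0 zero_mem_unitDisk
  simp only [Pi.sub_apply] at h1 h2
  rw [← h2, h0, sub_self] at h1
  exact sub_eq_zero.1 h1

lemma eqOn_of_re_eq {F G : ℂ → ℂ} (hF : DifferentiableOn ℂ F unitDisk)
    (hG : DifferentiableOn ℂ G unitDisk) (h0 : F 0 = G 0)
    (h : ∀ z ∈ unitDisk, (F z).re = (G z).re) : EqOn F G unitDisk := fun z hz =>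
  mul_left_cancel₀ Complex.I_ne_zero (eqOn_of_im_eq (hF.const_mul Complex.I)
    (hG.const_mul Complex.I) (by rw [h0]) (fun w hw => by simpa using h w hw) hz)

lemma eqOn_of_deriv_eq {F G : ℂ → ℂ} (hF : DifferentiableOn ℂ F unitDisk)
    (hG : DifferentiableOn ℂ G unitDisk) (h0 : F 0 = G 0)
    (h : ∀ z ∈ unitDisk, deriv F z = deriv G z) : EqOn F G unitDisk :=
  isOpen_ball.eqOn_of_deriv_eq isConnected_unitDisk.isPreconnected hF hG h zero_mem_unitDisk h0

/-- An analytic factor with `φ 0 ≠ 0` can be cancelled in identities between analytic functions,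
even though it may have zeros in the disk. -/
lemma eqOn_of_mul_eq {p₁ p₂ φ : ℂ → ℂ} (h₁ : DifferentiableOn ℂ p₁ unitDisk)
    (h₂ : DifferentiableOn ℂ p₂ unitDisk) (hφ : DifferentiableOn ℂ φ unitDisk) (h0 : φ 0 ≠ 0)
    (h : ∀ z ∈ unitDisk, p₁ z * φ z = p₂ z * φ z) : EqOn p₁ p₂ unitDisk := by
  refine AnalyticOnNhd.eqOn_of_preconnected_of_eventuallyEq (h₁.analyticOnNhd isOpen_ball)
    (h₂.analyticOnNhd isOpen_ball) isConnected_unitDisk.isPreconnected zero_mem_unitDisk ?_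
  filter_upwards [(differentiableAt_of_mem hφ zero_mem_unitDisk).continuousAt.eventually_ne h0,
    isOpen_ball.mem_nhds zero_mem_unitDisk] with z hz hm
  exact mul_right_cancel₀ hz (h z hm)

/-- The local dilatations of a sense-preserving harmonic function are the germs of one analytic
function. -/
lemma exists_dilatation {h g : ℂ → ℂ} (hh : AnalyticOnNhd ℂ h unitDisk)
    (hs : ∀ z ∈ unitDisk, SensePreservingAt h g z) :
    ∃ ω : ℂ → ℂ, DifferentiableOn ℂ ω unitDisk ∧
      ∀ z ∈ unitDisk, deriv g z = ω z * deriv h z ∧ ‖ω z‖ < 1 := by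
  choose! ω hω hω' hω1 using fun z hz => (hs z hz).2
  refine ⟨fun z => ω z z, fun z hz => ?_, fun z hz => ⟨(hω' z hz).self_of_nhds, hω1 z hz⟩⟩
  refine DifferentiableAt.differentiableWithinAt ?_
  refine (hω z hz).differentiableAt.congr_of_eventuallyEq ?_
  filter_upwards [(hω' z hz).eventually_nhds, (hω z hz).eventually_analyticAt,
    isOpen_ball.mem_nhds hz] with w hw hwa hwm
  have h1 : ∀ᶠ v in 𝓝 w, (ω w v - ω z v) * deriv h v = 0 := by
    filter_upwards [hw, hω' w hwm] with v e1 e2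
    linear_combination e1 - e2
  have ha := (hω w hwm).sub hwa
  rcases ha.eventually_eq_zero_or_eventually_ne_zero with h2 | h2
  · exact sub_eq_zero.1 h2.self_of_nhds
  · have h3 : ∀ᶠ v in 𝓝[≠] w, deriv h v = 0 := by
      filter_upwards [h2, h1.filter_mono nhdsWithin_le_nhds] with v e1 e2
      exact (mul_eq_zero.1 e2).resolve_left e1
    exact absurd ((hh w hwm).deriv.frequently_zero_iff_eventually_zero.1 h3.frequently) (hs w hwm).1

lemma eq_re_add_I_mul_im (a b : ℂ) :
    a + conj b = ((a + b).re : ℂ) + Complex.I * ((a - b).im : ℂ) := by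
  apply Complex.ext <;> simp [sub_eq_add_neg]

lemma deriv_im_eq_zero_of_real {F : ℂ → ℂ} (hF : DifferentiableOn ℂ F unitDisk)
    (hr : ∀ z ∈ unitDisk, z.im = 0 → (F z).im = 0) : (deriv F 0).im = 0 := by
  simpa [dslope_same] using im_dslope_eq_zero hF hr 0 zero_mem_unitDisk rfl

/-- Every function of the class is a shear. -/
lemma exists_isShear {f : unitDisk → ℂ} (hf : f ∈ classTHO) : ∃ p F H, IsShear f p F H := by
  obtain ⟨h, g, T, hg0⟩ := hf
  have hh := T.decomposition.analytic_h
  have hg := T.decomposition.analytic_g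
  have hhd : DifferentiableOn ℂ h unitDisk := hh.differentiableOn
  have hgd : DifferentiableOn ℂ g unitDisk := hg.differentiableOn
  obtain ⟨ω, hωd, hω⟩ := exists_dilatation hh T.sensePreserving
  have hf0 : h 0 + conj (g 0) = 0 := (T.decomposition.eq diskCenter).symm.trans T.map_zero
  have hfre : (h 0).re + (g 0).re = 0 := by simpa using congrArg Complex.re hf0
  have hfim : (h 0).im - (g 0).im = 0 := by
    simpa [sub_eq_add_neg] using congrArg Complex.im hf0
  have hdF : ∀ z ∈ unitDisk, HasDerivAt (fun z => h z - g z - (h 0 - g 0))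
      (deriv h z - deriv g z) z := fun z hz =>
    ((differentiableAt_of_mem hhd hz).hasDerivAt.sub
      (differentiableAt_of_mem hgd hz).hasDerivAt).sub_const _
  have hdH : ∀ z ∈ unitDisk, HasDerivAt (fun z => h z + g z - (h 0 + g 0))
      (deriv h z + deriv g z) z := fun z hz =>
    ((differentiableAt_of_mem hhd hz).hasDerivAt.add
      (differentiableAt_of_mem hgd hz).hasDerivAt).sub_const _
  have hFd : DifferentiableOn ℂ (fun z => h z - g z - (h 0 - g 0)) unitDisk := by fun_prop
  have hHd : DifferentiableOn ℂ (fun z => h z + g z - (h 0 + g 0)) unitDisk := by fun_prop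
  have hFim : ∀ z : unitDisk, (h z - g z - (h 0 - g 0)).im = (f z).im := fun z => by
    rw [T.decomposition.eq z]
    simp only [Complex.sub_im, Complex.add_im, Complex.conj_im, hfim]; ring
  have hHre : ∀ z : unitDisk, (h z + g z - (h 0 + g 0)).re = (f z).re := fun z => by
    rw [T.decomposition.eq z]
    simp only [Complex.sub_re, Complex.add_re, Complex.conj_re, hfre]; ring
  have hreal : ∀ z ∈ unitDisk, z.im = 0 → (h z - g z - (h 0 - g 0)).im = 0 := fun z hz hi =>
    (hFim ⟨z, hz⟩).trans ((T.real_iff ⟨z, hz⟩).2 hi)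
  have hreal' : ∀ z ∈ unitDisk, (h z - g z - (h 0 - g 0)).im = 0 → z.im = 0 := fun z hz hi =>
    (T.real_iff ⟨z, hz⟩).1 ((hFim ⟨z, hz⟩).symm.trans hi)
  -- `h' 0` is real, of modulus one, and nonnegative
  have him : (deriv h 0).im = 0 := by
    have := deriv_im_eq_zero_of_real hFd hreal
    rwa [(hdF 0 zero_mem_unitDisk).deriv, hg0, sub_zero] at this
  have hre : (deriv h 0).re = 1 := by
    have h1 : |(deriv h 0).re| = 1 := by
      have := T.norm_deriv_zero
      rwa [← Complex.re_add_im (deriv h 0), him, Complex.ofReal_zero, zero_mul, add_zero,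
        Complex.norm_real] at this
    rcases eq_or_eq_neg_of_abs_eq h1 with h2 | h2
    · exact h2
    exfalso
    have hneg : DifferentiableOn ℂ (fun z => -(h z + g z - (h 0 + g 0))) unitDisk := hHd.neg
    obtain ⟨δ, hδ0, hδ1, hδ⟩ := exists_re_dslope_pos hneg (by
      rw [deriv.fun_neg, (hdH 0 zero_mem_unitDisk).deriv, hg0, add_zero, Complex.neg_re, h2]
      norm_num)
    have hm := ofReal_mem_unitDisk hδ0.le hδ1
    have h3 := hδ δ (by rw [Complex.norm_real, Real.norm_of_nonneg hδ0.le])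
    have h4 := congrArg Complex.re
      (eq_add_mul_dslope (fun z => -(h z + g z - (h 0 + g 0))) (δ : ℂ))
    have h5 := (T.pos ⟨δ, hm⟩ (Complex.ofReal_im δ) hδ0).2
    rw [Complex.add_re, Complex.re_ofReal_mul, Complex.neg_re, hHre ⟨δ, hm⟩] at h4
    simp only [sub_self, neg_zero, Complex.zero_re, zero_add] at h4
    nlinarith [mul_pos hδ0 h3]
  have hd1 : deriv h 0 = 1 := Complex.ext hre him
  have hω1 : ∀ z ∈ unitDisk, 1 - ω z ≠ 0 := fun z hz => one_sub_ne_zero (hω z hz).2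
  have hF1 : deriv (fun z => h z - g z - (h 0 - g 0)) 0 = 1 := by
    rw [(hdF 0 zero_mem_unitDisk).deriv, hg0, hd1, sub_zero]
  refine ⟨fun z => (1 + ω z) / (1 - ω z), fun z => h z - g z - (h 0 - g 0),
    fun z => h z + g z - (h 0 + g 0), ?_, ?_, hF1, hHd, by simp, fun z hz => ?_, fun z => ?_⟩
  · refine ⟨DifferentiableOn.div (by fun_prop) (by fun_prop) hω1, ?_,
      fun z hz => re_one_add_div_one_sub_nonneg (hω z hz).2⟩
    have := (hω 0 zero_mem_unitDisk).1
    rw [hg0, hd1, mul_one] at this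
    simp [← this]
  · exact ⟨hFd, by simp, hreal, im_mul_im_nonneg_of_im_ne_zero hFd (by simp)
      (by rw [hF1]; norm_num) hreal'⟩
  · rw [(hdF z hz).deriv, (hdH z hz).deriv, (hω z hz).1, div_mul_eq_mul_div,
      eq_div_iff (hω1 z hz)]
    ring
  · have h1 := hFim z
    have h2 := hHre z
    rw [h1, h2]
    apply Complex.ext <;> simp

/-- The imaginary part of a normalized typically real function vanishes on the real axis only. -/
lemma IsTypicallyReal.im_eq_zero_iff {F : ℂ → ℂ} (hF : IsTypicallyReal F) (h1 : deriv F 0 = 1)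
    {z : ℂ} (hz : z ∈ unitDisk) : (F z).im = 0 ↔ z.im = 0 := by
  have key : ∀ {G : ℂ → ℂ}, IsTypicallyReal G → deriv G 0 = 1 → ∀ z ∈ unitDisk, 0 < z.im →
      (G z).im ≠ 0 := by
    intro G hG hG1 z hz hi h0
    have hd : DifferentiableOn ℂ (fun w => -Complex.I * G w) (unitDisk ∩ {z : ℂ | 0 < z.im}) :=
      (hG.diff.mono inter_subset_left).const_mul _
    have e1 : ∀ w ∈ unitDisk ∩ {z : ℂ | 0 < z.im}, -Complex.I * G w = -Complex.I * G z :=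
      fun w hw => eq_of_re_nonneg_of_re_eq_zero isOpen_upperHalfDisk isConnected_upperHalfDisk hd
        (fun v hv => by
          have := nonneg_of_mul_nonneg_right (hG.im_nonneg v hv.1) hv.2
          simpa using this) ⟨hz, hi⟩ (by simp [h0]) hw
    have e2 : EqOn G (fun _ => G z) unitDisk := by
      refine AnalyticOnNhd.eqOn_of_preconnected_of_eventuallyEq
        (hG.diff.analyticOnNhd isOpen_ball) analyticOnNhd_const
        isConnected_unitDisk.isPreconnected hz ?_
      filter_upwards [isOpen_upperHalfDisk.mem_nhds ⟨hz, hi⟩] with w hw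
      exact mul_left_cancel₀ (neg_ne_zero.2 Complex.I_ne_zero) (e1 w hw)
    have e3 := (e2.eventuallyEq_of_mem (isOpen_ball.mem_nhds zero_mem_unitDisk)).deriv_eq
    rw [hG1, deriv_const] at e3
    exact one_ne_zero e3
  refine ⟨fun h => ?_, hF.im_eq_zero z hz⟩
  rcases lt_trichotomy z.im 0 with hi | hi | hi
  · have hF' : IsTypicallyReal (fun w => -F (-w)) := by
      refine ⟨(hF.diff.comp (differentiableOn_neg _) fun w hw => by simpa using hw).neg,
        by simp [hF.map_zero], fun w hw h => ?_, fun w hw => ?_⟩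
      · simpa using hF.im_eq_zero (-w) (by simpa using hw) (by simpa using h)
      · simpa using hF.im_nonneg (-w) (by simpa using hw)
    exact absurd (by simpa using h) (key hF'
      (by rw [deriv.fun_neg, deriv_comp_neg, neg_zero, neg_neg, h1]) (-z) (by simpa using hz)
      (by simpa using hi))
  · exact hi
  · exact absurd h (key hF h1 z hz hi)

/-- On the real axis the derivative of a typically real function is real and nonnegative. -/
lemma IsTypicallyReal.deriv_ofReal {F : ℂ → ℂ} (hF : IsTypicallyReal F) {x : ℝ}
    (hx : (x : ℂ) ∈ unitDisk) : (deriv F x).im = 0 ∧ 0 ≤ (deriv F x).re := by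
  have hd : ContinuousAt (dslope F x) x :=
    continuousAt_dslope_same.2 (differentiableAt_of_mem hF.diff hx)
  have hadd : ∀ z, F z = F x + (z - x) * dslope F x z := fun z => by
    have := sub_smul_dslope F x z
    rw [smul_eq_mul] at this
    rw [this]; ring
  have hFx := hF.im_eq_zero x hx (Complex.ofReal_im x)
  -- approach `x` along the real axis and along the vertical line through `x`
  have ht : ∀ v : ℂ, Tendsto (fun t : ℝ => (x : ℂ) + t * v) (𝓝[>] 0) (𝓝 x) := fun v => by
    have : ContinuousAt (fun t : ℝ => (x : ℂ) + t * v) 0 := by fun_prop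
    simpa using this.tendsto.mono_left nhdsWithin_le_nhds
  have hm : ∀ v : ℂ, ∀ᶠ t : ℝ in 𝓝[>] 0, (x : ℂ) + t * v ∈ unitDisk := fun v =>
    (ht v).eventually (isOpen_ball.mem_nhds hx)
  rw [← dslope_same]
  constructor
  · refine tendsto_nhds_unique_of_eventuallyEq
      ((Complex.continuous_im.tendsto _).comp (hd.tendsto.comp (ht 1))) tendsto_const_nhds ?_
    filter_upwards [hm 1, self_mem_nhdsWithin] with t h1 h2
    have h3 := congrArg Complex.im (hadd (x + t * 1))
    rw [hF.im_eq_zero _ h1 (by simp), Complex.add_im, hFx, add_sub_cancel_left, mul_one,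
      Complex.im_ofReal_mul] at h3
    simpa [ne_of_gt (show (0 : ℝ) < t from h2)] using h3.symm
  · refine ge_of_tendsto
      ((Complex.continuous_re.tendsto _).comp (hd.tendsto.comp (ht Complex.I))) ?_
    filter_upwards [hm Complex.I, self_mem_nhdsWithin] with t h1 h2
    have h0 : (0 : ℝ) < t := h2
    have h3 := congrArg Complex.im (hadd (x + t * Complex.I))
    have h4 := hF.im_nonneg _ h1
    have h5 : ((x : ℂ) + t * Complex.I).im = t := by simp
    rw [Complex.add_im, hFx, add_sub_cancel_left, mul_assoc, Complex.im_ofReal_mul,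
      Complex.I_mul_im, zero_add] at h3
    rw [h3, h5, ← mul_assoc] at h4
    exact nonneg_of_mul_nonneg_right h4 (mul_pos h0 h0)

/-- Along the radius `(0, 1)` the real part of a shear is positive, since it has the derivative
`Re p * F' ≥ 0`, and the derivative `1` at the origin. -/
lemma IsShear.re_pos {f : unitDisk → ℂ} {p F H : ℂ → ℂ} (hs : IsShear f p F H) {x : ℝ}
    (hx0 : 0 < x) (hx1 : x < 1) : 0 < (H x).re := by
  have hH1 : deriv H 0 = 1 := by
    rw [hs.deriv_eq 0 zero_mem_unitDisk, hs.isCaratheodory.map_zero, hs.deriv_zero, one_mul]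
  obtain ⟨δ, hδ0, hδ1, hδ⟩ := exists_re_dslope_pos hs.diff (by rw [hH1]; norm_num)
  have hmono : MonotoneOn (fun t : ℝ => (H t).re) (Ico 0 1) := by
    have hder : ∀ t ∈ Ico (0 : ℝ) 1, HasDerivAt (fun t : ℝ => (H t).re) (deriv H t).re t :=
      fun t ht => (differentiableAt_of_mem hs.diff
        (ofReal_mem_unitDisk ht.1 ht.2)).hasDerivAt.real_of_complex
    refine monotoneOn_of_deriv_nonneg (convex_Ico 0 1)
      (fun t ht => (hder t ht).continuousAt.continuousWithinAt)
      (fun t ht => (hder t (interior_subset ht)).differentiableAt.differentiableWithinAt)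
      fun t ht => ?_
    have ht' := interior_subset ht
    have hm := ofReal_mem_unitDisk ht'.1 ht'.2
    rw [(hder t ht').deriv, hs.deriv_eq t hm]
    obtain ⟨h1, h2⟩ := hs.isTypicallyReal.deriv_ofReal hm
    rw [Complex.mul_re, h1, mul_zero, sub_zero]
    exact mul_nonneg (hs.isCaratheodory.re_nonneg t hm) h2
  have hmin : 0 < min δ x := lt_min hδ0 hx0
  have h1 : 0 < (H (min δ x : ℝ)).re := by
    rw [eq_add_mul_dslope H, hs.map_zero, zero_add, Complex.re_ofReal_mul]
    refine mul_pos hmin (hδ _ ?_)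
    rw [Complex.norm_real, Real.norm_of_nonneg hmin.le]
    exact min_le_left _ _
  exact h1.trans_le (hmono ⟨hmin.le, (min_le_right _ _).trans_lt hx1⟩ ⟨hx0.le, hx1⟩
    (min_le_right _ _))

/-- Every shear belongs to the class. -/
lemma IsShear.mem_classTHO {f : unitDisk → ℂ} {p F H : ℂ → ℂ} (hs : IsShear f p F H) :
    f ∈ classTHO := by
  have hp := hs.isCaratheodory
  have hF := hs.isTypicallyReal
  have hFd := hF.diff
  have hHd := hs.diff
  have hpd := hp.diff
  have hhd : DifferentiableOn ℂ (fun z => (H z + F z) / 2) unitDisk := by fun_prop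
  have hgd : DifferentiableOn ℂ (fun z => (H z - F z) / 2) unitDisk := by fun_prop
  have hh := hhd.analyticOnNhd isOpen_ball
  have hg := hgd.analyticOnNhd isOpen_ball
  have hdh : ∀ z ∈ unitDisk, deriv (fun z => (H z + F z) / 2) z = (p z + 1) / 2 * deriv F z :=
    fun z hz => by
      have := (((differentiableAt_of_mem hHd hz).hasDerivAt.add
        (differentiableAt_of_mem hFd hz).hasDerivAt).div_const 2).deriv
      refine this.trans ?_
      rw [hs.deriv_eq z hz]; ring
  have hdg : ∀ z ∈ unitDisk, deriv (fun z => (H z - F z) / 2) z = (p z - 1) / 2 * deriv F z :=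
    fun z hz => by
      have := (((differentiableAt_of_mem hHd hz).hasDerivAt.sub
        (differentiableAt_of_mem hFd hz).hasDerivAt).div_const 2).deriv
      refine this.trans ?_
      rw [hs.deriv_eq z hz]; ring
  have heq : ∀ z : unitDisk, f z = (H z + F z) / 2 + conj ((H z - F z) / 2) := fun z => by
    rw [hs.eq z, eq_re_add_I_mul_im]
    congr 4 <;> ring
  have hp1 : ∀ z ∈ unitDisk, p z + 1 ≠ 0 := fun z hz h => by
    have h1 := hp.re_nonneg z hz
    rw [eq_neg_of_add_eq_zero_left h] at h1
    norm_num at h1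
  have hfim : ∀ z : unitDisk, (f z).im = (F z).im := fun z => by rw [hs.eq z]; simp
  have hfre : ∀ z : unitDisk, (f z).re = (H z).re := fun z => by rw [hs.eq z]; simp
  refine ⟨fun z => (H z + F z) / 2, fun z => (H z - F z) / 2, ⟨?_, ⟨hh, hg, heq⟩, ?_, ?_, ?_, ?_,
    ?_⟩, ?_⟩
  · exact ⟨fun z => (H z + F z) / 2 + conj ((H z - F z) / 2), fun z hz =>
      (hh z hz).harmonicAt.add (hg z hz).harmonicAt_conj, heq⟩
  · intro z hz
    refine ⟨fun h => ?_, fun w => (p w - 1) / (p w + 1), ?_, ?_, ?_⟩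
    · have h1 : ∀ᶠ w in 𝓝 z, deriv F w = 0 := by
        filter_upwards [h, isOpen_ball.mem_nhds hz] with w h2 hw
        rw [hdh w hw] at h2
        exact (mul_eq_zero.1 h2).resolve_left (div_ne_zero (hp1 w hw) two_ne_zero)
      have h2 := AnalyticOnNhd.eqOn_zero_of_preconnected_of_eventuallyEq_zero
        (hFd.analyticOnNhd isOpen_ball).deriv isConnected_unitDisk.isPreconnected hz h1
        zero_mem_unitDisk
      rw [hs.deriv_zero] at h2
      exact one_ne_zero h2
    · exact (((hpd.analyticOnNhd isOpen_ball) z hz).sub analyticAt_const).div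
        (((hpd.analyticOnNhd isOpen_ball) z hz).add analyticAt_const) (hp1 z hz)
    · filter_upwards [isOpen_ball.mem_nhds hz] with w hw
      have := hp1 w hw
      rw [hdg w hw, hdh w hw]
      field_simp
    · rw [norm_div, div_lt_one (norm_pos_iff.2 (hp1 z hz)), ← sq_lt_sq₀ (norm_nonneg _)
        (norm_nonneg _), ← Complex.normSq_eq_norm_sq, ← Complex.normSq_eq_norm_sq,
        Complex.normSq_apply, Complex.normSq_apply]
      have := hp.re_pos hz
      simp
      nlinarith
  · intro z
    rw [hfim z]
    exact hF.im_eq_zero_iff hs.deriv_zero z.2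
  · rw [heq]
    simp [diskCenter, hs.map_zero, hF.map_zero]
  · rw [hdh 0 zero_mem_unitDisk, hp.map_zero, hs.deriv_zero]; norm_num
  · intro z hi hr
    have hz : (z : ℂ) = ((z : ℂ).re : ℂ) := Complex.ext rfl (by simpa using hi)
    refine ⟨by rw [hfim z]; exact hF.im_eq_zero _ z.2 hi, ?_⟩
    rw [hfre z, hz]
    exact hs.re_pos hr ((Complex.re_le_norm _).trans_lt (mem_unitDisk.1 z.2))
  · rw [hdg 0 zero_mem_unitDisk, hp.map_zero, sub_self, zero_div, zero_mul]

/-- The data `p` and `F` of a shear are determined by the function. -/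
lemma IsShear.unique {f : unitDisk → ℂ} {p₁ F₁ H₁ p₂ F₂ H₂ : ℂ → ℂ} (h₁ : IsShear f p₁ F₁ H₁)
    (h₂ : IsShear f p₂ F₂ H₂) : EqOn F₁ F₂ unitDisk ∧ EqOn p₁ p₂ unitDisk := by
  have hF : EqOn F₁ F₂ unitDisk := eqOn_of_im_eq h₁.isTypicallyReal.diff h₂.isTypicallyReal.diff
    (by rw [h₁.isTypicallyReal.map_zero, h₂.isTypicallyReal.map_zero]) fun z hz => by
      simpa using congrArg Complex.im ((h₁.eq ⟨z, hz⟩).symm.trans (h₂.eq ⟨z, hz⟩))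
  have hH : EqOn H₁ H₂ unitDisk := eqOn_of_re_eq h₁.diff h₂.diff
    (by rw [h₁.map_zero, h₂.map_zero]) fun z hz => by
      simpa using congrArg Complex.re ((h₁.eq ⟨z, hz⟩).symm.trans (h₂.eq ⟨z, hz⟩))
  refine ⟨hF, eqOn_of_mul_eq h₁.isCaratheodory.diff h₂.isCaratheodory.diff
    (h₂.isTypicallyReal.diff.deriv isOpen_ball) (by rw [h₂.deriv_zero]; exact one_ne_zero)
    fun z hz => ?_⟩
  rw [← h₂.deriv_eq z hz, ← (hF.eventuallyEq_of_mem (isOpen_ball.mem_nhds hz)).deriv_eq,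
    ← h₁.deriv_eq z hz, (hH.eventuallyEq_of_mem (isOpen_ball.mem_nhds hz)).deriv_eq]

lemma integral_segment_eq {H φ : ℂ → ℂ} (hH : DifferentiableOn ℂ H unitDisk) (h0 : H 0 = 0)
    (hφ : ∀ z ∈ unitDisk, deriv H z = φ z) {z : ℂ} (hz : z ∈ unitDisk) :
    ∫ s in (0 : ℝ)..1, φ (s * z) * z = H z := by
  have hm : ∀ s ∈ uIcc (0 : ℝ) 1, (s : ℂ) * z ∈ unitDisk := fun s hs => by
    rw [uIcc_of_le zero_le_one] at hs
    rw [mem_unitDisk, norm_mul, Complex.norm_real, Real.norm_of_nonneg hs.1]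
    have := mem_unitDisk.1 hz
    nlinarith [hs.2, norm_nonneg z]
  have hder : ∀ s ∈ uIcc (0 : ℝ) 1, HasDerivAt (fun s : ℝ => H (s * z)) (φ (s * z) * z) s :=
    fun s hs => by
      have h1 := (differentiableAt_of_mem hH (hm s hs)).hasDerivAt
      rw [hφ _ (hm s hs)] at h1
      have h2 : HasDerivAt (fun s : ℝ => (s : ℂ) * z) (1 * z) s :=
        Complex.ofRealCLM.hasDerivAt.mul_const z
      have h3 := h1.comp s h2
      rwa [one_mul] at h3
  have hcont : ContinuousOn (fun s : ℝ => φ (s * z) * z) (uIcc 0 1) := by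
    refine ContinuousOn.mul ?_ continuousOn_const
    have h1 : ContinuousOn (deriv H) unitDisk := (hH.deriv isOpen_ball).continuousOn
    have h2 : ContinuousOn φ unitDisk := h1.congr fun w hw => (hφ w hw).symm
    exact h2.comp (by fun_prop) hm
  rw [intervalIntegral.integral_eq_sub_of_hasDerivAt hder hcont.intervalIntegrable]
  simp [h0]

/-- A shear is given by the integral formula. -/
lemma IsShear.eq_shear {f : unitDisk → ℂ} {p F H : ℂ → ℂ} (hs : IsShear f p F H) :
    f = fun z : unitDisk => shear p F z := by
  funext z
  rw [hs.eq z, shear, integral_segment_eq (φ := fun z => p z * deriv F z) hs.diff hs.map_zero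
    hs.deriv_eq z.2]

lemma exists_isShear_shear {p F : ℂ → ℂ} (hp : IsCaratheodory p) (hF : IsTypicallyReal F)
    (h1 : deriv F 0 = 1) : ∃ H, IsShear (fun z : unitDisk => shear p F z) p F H := by
  have hd : DifferentiableOn ℂ (fun z => p z * deriv F z) unitDisk :=
    hp.diff.mul (hF.diff.deriv isOpen_ball)
  obtain ⟨H, h0, hH⟩ := hd.isExactOn_ball.with_val_at 0 0
  have hHd : DifferentiableOn ℂ H unitDisk := fun z hz =>
    (hH z hz).differentiableAt.differentiableWithinAt
  refine ⟨H, hp, hF, h1, hHd, h0, fun z hz => (hH z hz).deriv, fun z => ?_⟩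
  rw [shear, integral_segment_eq (φ := fun z => p z * deriv F z) hHd h0
    (fun z hz => (hH z hz).deriv) z.2]

lemma IsShear.congr {f : unitDisk → ℂ} {p F H p' F' : ℂ → ℂ} (hs : IsShear f p F H)
    (hp : EqOn p p' unitDisk) (hF : EqOn F F' unitDisk) (hp' : IsCaratheodory p')
    (hF' : IsTypicallyReal F') : IsShear f p' F' H := by
  have hd : ∀ z ∈ unitDisk, deriv F z = deriv F' z := fun z hz =>
    (hF.eventuallyEq_of_mem (isOpen_ball.mem_nhds hz)).deriv_eq
  exact ⟨hp', hF', (hd 0 zero_mem_unitDisk).symm.trans hs.deriv_zero, hs.diff, hs.map_zero,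
    fun z hz => by rw [hs.deriv_eq z hz, hp hz, hd z hz], fun z => by rw [hs.eq z, hF z.2]⟩

/-! ### Normal families and compactness -/

/-- A family of functions on the unit disk is uniformly bounded on every smaller disk. -/
def IsLocallyBoundedFamily {ι : Type*} (Φ : ι → ℂ → ℂ) : Prop :=
  ∀ r < 1, ∃ B, ∀ i z, ‖z‖ ≤ r → ‖Φ i z‖ ≤ B

lemma IsLocallyBoundedFamily.deriv {ι : Type*} {Φ : ι → ℂ → ℂ} (hb : IsLocallyBoundedFamily Φ)
    (hd : ∀ i, DifferentiableOn ℂ (Φ i) unitDisk) :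
    IsLocallyBoundedFamily (fun i => deriv (Φ i)) := by
  intro r hr
  obtain ⟨B, hB⟩ := hb ((r + 1) / 2) (by linarith)
  refine ⟨B / ((1 - r) / 2), fun i z hz => ?_⟩
  have hsub : closedBall z ((1 - r) / 2) ⊆ closedBall 0 ((r + 1) / 2) := fun w hw => by
    rw [mem_closedBall_zero_iff]
    have h1 : ‖w - z‖ ≤ (1 - r) / 2 := by rw [← dist_eq_norm]; exact hw
    calc ‖w‖ = ‖(w - z) + z‖ := by rw [sub_add_cancel]
      _ ≤ ‖w - z‖ + ‖z‖ := norm_add_le _ _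
      _ ≤ _ := by linarith
  refine Complex.norm_deriv_le_of_forall_mem_sphere_norm_le (by linarith)
    (DifferentiableOn.diffContOnCl ((hd i).mono fun w hw => ?_)) fun w hw => ?_
  · have := mem_closedBall_zero_iff.1 (hsub (closure_ball_subset_closedBall hw))
    exact mem_unitDisk.2 (by linarith)
  · exact hB i w (mem_closedBall_zero_iff.1 (hsub (sphere_subset_closedBall hw)))

/-- A version of **Montel's theorem**: a locally bounded family of analytic functions converges
locally uniformly along every ultrafilter. -/
lemma IsLocallyBoundedFamily.exists_tendstoLocallyUniformlyOn {ι : Type*} {Φ : ι → ℂ → ℂ}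
    (hb : IsLocallyBoundedFamily Φ) (hd : ∀ i, DifferentiableOn ℂ (Φ i) unitDisk)
    (𝒰 : Ultrafilter ι) : ∃ Ψ : ℂ → ℂ, TendstoLocallyUniformlyOn Φ Ψ 𝒰 unitDisk := by
  have hlim : ∀ z ∈ unitDisk, ∃ w, Tendsto (fun i => Φ i z) 𝒰 (𝓝 w) := fun z hz => by
    obtain ⟨B, hB⟩ := hb ‖z‖ (mem_unitDisk.1 hz)
    obtain ⟨w, -, hw⟩ := (isCompact_closedBall (0 : ℂ) B).ultrafilter_le_nhds
      (𝒰.map fun i => Φ i z) (by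
        rw [le_principal_iff]
        exact Filter.mem_map.2 (Filter.univ_mem' fun i =>
          mem_closedBall_zero_iff.2 (hB i z le_rfl)))
    exact ⟨w, hw⟩
  choose! Ψ hΨ using hlim
  refine ⟨Ψ, Metric.tendstoLocallyUniformlyOn_iff.2 fun ε hε x hx => ?_⟩
  have hx1 := mem_unitDisk.1 hx
  -- a common Lipschitz constant near `x`
  obtain ⟨L, hL⟩ := hb.deriv hd ((‖x‖ + 1) / 2) (by linarith)
  set L' := max L 1
  have hL' : 0 < L' := lt_max_of_lt_right one_pos
  set δ := min ((1 - ‖x‖) / 2) (ε / (4 * L'))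
  have hδ0 : 0 < δ := lt_min (by linarith) (by positivity)
  have hsub : ∀ y ∈ ball x δ, ‖y‖ ≤ (‖x‖ + 1) / 2 := fun y hy => by
    have h1 : ‖y - x‖ < δ := by rw [← dist_eq_norm]; exact hy
    have h2 := min_le_left ((1 - ‖x‖) / 2) (ε / (4 * L'))
    calc ‖y‖ = ‖(y - x) + x‖ := by rw [sub_add_cancel]
      _ ≤ ‖y - x‖ + ‖x‖ := norm_add_le _ _
      _ ≤ _ := by linarith
  have hsub' : ∀ y ∈ ball x δ, y ∈ unitDisk := fun y hy =>
    mem_unitDisk.2 ((hsub y hy).trans_lt (by linarith))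
  have hlip : ∀ i, ∀ y ∈ ball x δ, dist (Φ i y) (Φ i x) ≤ ε / 4 := fun i y hy => by
    have h1 := (convex_ball x δ).norm_image_sub_le_of_norm_deriv_le (f := Φ i) (C := L')
      (fun w hw => differentiableAt_of_mem (hd i) (hsub' w hw))
      (fun w hw => (hL i w (hsub w hw)).trans (le_max_left _ _)) (mem_ball_self hδ0) hy
    have h2 : ‖y - x‖ ≤ ε / (4 * L') := by
      rw [← dist_eq_norm]
      exact (mem_ball.1 hy).le.trans (min_le_right _ _)
    rw [dist_eq_norm]
    calc _ ≤ L' * ‖y - x‖ := h1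
      _ ≤ L' * (ε / (4 * L')) := by gcongr
      _ = ε / 4 := by field_simp
  have hlip' : ∀ y ∈ ball x δ, dist (Ψ y) (Ψ x) ≤ ε / 4 := fun y hy =>
    le_of_tendsto ((hΨ y (hsub' y hy)).dist (hΨ x hx)) (Eventually.of_forall fun i => hlip i y hy)
  refine ⟨ball x δ, mem_nhdsWithin_of_mem_nhds (ball_mem_nhds x hδ0), ?_⟩
  filter_upwards [Metric.tendsto_nhds.1 (hΨ x hx) (ε / 4) (by positivity)] with i hi y hy
  calc dist (Ψ y) (Φ i y) ≤ dist (Ψ y) (Ψ x) + dist (Ψ x) (Φ i x) + dist (Φ i x) (Φ i y) :=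
        dist_triangle4 _ _ _ _
    _ ≤ ε / 4 + ε / 4 + ε / 4 := by
        rw [dist_comm (Ψ x) (Φ i x), dist_comm (Φ i x) (Φ i y)]
        exact add_le_add (add_le_add (hlip' y hy) hi.le) (hlip i y hy)
    _ < ε := by linarith

/-- The shears are closed under locally uniform limits of their data. -/
lemma IsShear.of_tendsto {ι : Type*} {l : Filter ι} [l.NeBot] {f : ι → unitDisk → ℂ}
    {p F H : ι → ℂ → ℂ} {p₀ F₀ H₀ : ℂ → ℂ} (hs : ∀ i, IsShear (f i) (p i) (F i) (H i))
    (hp : TendstoLocallyUniformlyOn p p₀ l unitDisk)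
    (hF : TendstoLocallyUniformlyOn F F₀ l unitDisk)
    (hH : TendstoLocallyUniformlyOn H H₀ l unitDisk) :
    IsShear (fun z => ((H₀ z).re : ℂ) + Complex.I * ((F₀ z).im : ℂ)) p₀ F₀ H₀ := by
  have hFd : ∀ᶠ i in l, DifferentiableOn ℂ (F i) unitDisk :=
    Eventually.of_forall fun i => (hs i).isTypicallyReal.diff
  have hHd : ∀ᶠ i in l, DifferentiableOn ℂ (H i) unitDisk :=
    Eventually.of_forall fun i => (hs i).diff
  have hF' := hF.deriv hFd isOpen_ball
  have hH' := hH.deriv hHd isOpen_ball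
  refine ⟨⟨hp.differentiableOn (Eventually.of_forall fun i => (hs i).isCaratheodory.diff)
      isOpen_ball, ?_, fun z hz => ?_⟩,
    ⟨hF.differentiableOn hFd isOpen_ball, ?_, fun z hz hi => ?_, fun z hz => ?_⟩, ?_,
    hH.differentiableOn hHd isOpen_ball, ?_, fun z hz => ?_, fun z => rfl⟩
  · exact tendsto_nhds_unique_of_eventuallyEq (hp.tendsto_at zero_mem_unitDisk) tendsto_const_nhds
      (Eventually.of_forall fun i => (hs i).isCaratheodory.map_zero)
  · exact ge_of_tendsto ((Complex.continuous_re.tendsto _).comp (hp.tendsto_at hz))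
      (Eventually.of_forall fun i => (hs i).isCaratheodory.re_nonneg z hz)
  · exact tendsto_nhds_unique_of_eventuallyEq (hF.tendsto_at zero_mem_unitDisk) tendsto_const_nhds
      (Eventually.of_forall fun i => (hs i).isTypicallyReal.map_zero)
  · exact tendsto_nhds_unique_of_eventuallyEq
      ((Complex.continuous_im.tendsto _).comp (hF.tendsto_at hz)) tendsto_const_nhds
      (Eventually.of_forall fun i => (hs i).isTypicallyReal.im_eq_zero z hz hi)
  · exact ge_of_tendsto (((Complex.continuous_im.tendsto _).comp (hF.tendsto_at hz)).const_mul _)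
      (Eventually.of_forall fun i => (hs i).isTypicallyReal.im_nonneg z hz)
  · exact tendsto_nhds_unique_of_eventuallyEq (hF'.tendsto_at zero_mem_unitDisk)
      tendsto_const_nhds (Eventually.of_forall fun i => (hs i).deriv_zero)
  · exact tendsto_nhds_unique_of_eventuallyEq (hH.tendsto_at zero_mem_unitDisk) tendsto_const_nhds
      (Eventually.of_forall fun i => (hs i).map_zero)
  · exact tendsto_nhds_unique_of_eventuallyEq (hH'.tendsto_at hz)
      ((hp.tendsto_at hz).mul (hF'.tendsto_at hz))
      (Eventually.of_forall fun i => (hs i).deriv_eq z hz)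

lemma isLocallyBoundedFamily_of_isShear {ι : Type*} {f : ι → unitDisk → ℂ} {p F H : ι → ℂ → ℂ}
    (hs : ∀ i, IsShear (f i) (p i) (F i) (H i)) :
    IsLocallyBoundedFamily p ∧ IsLocallyBoundedFamily F ∧ IsLocallyBoundedFamily H := by
  have hp : IsLocallyBoundedFamily p := fun r hr =>
    ⟨_, fun i z hz => (hs i).isCaratheodory.norm_le hr hz⟩
  have hF : IsLocallyBoundedFamily F := fun r hr =>
    ⟨_, fun i z hz => (hs i).isTypicallyReal.norm_le (hs i).deriv_zero hr hz⟩
  refine ⟨hp, hF, fun r hr => ?_⟩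
  obtain ⟨A, hA⟩ := hp r hr
  obtain ⟨B, hB⟩ := hF.deriv (fun i => (hs i).isTypicallyReal.diff) r hr
  refine ⟨A * B, fun i z hz => ?_⟩
  have hr0 : 0 ≤ r := (norm_nonneg z).trans hz
  have hA0 : 0 ≤ A := (norm_nonneg _).trans (hA i z hz)
  have hB0 : 0 ≤ B := (norm_nonneg _).trans (hB i z hz)
  have hm : ∀ w ∈ closedBall (0 : ℂ) r, w ∈ unitDisk := fun w hw =>
    mem_unitDisk.2 ((mem_closedBall_zero_iff.1 hw).trans_lt hr)
  have h1 := (convex_closedBall (0 : ℂ) r).norm_image_sub_le_of_norm_deriv_le (f := H i)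
    (C := A * B) (fun w hw => differentiableAt_of_mem (hs i).diff (hm w hw))
    (fun w hw => by
      have hw' := mem_closedBall_zero_iff.1 hw
      rw [(hs i).deriv_eq w (hm w hw), norm_mul]
      exact mul_le_mul (hA i w hw') (hB i w hw') (norm_nonneg _) hA0)
    (mem_closedBall_self hr0) (mem_closedBall_zero_iff.2 hz)
  rw [(hs i).map_zero, sub_zero, sub_zero] at h1
  calc _ ≤ A * B * ‖z‖ := h1
    _ ≤ A * B * 1 := by gcongr; linarith
    _ = A * B := mul_one _

lemma isCaratheodory_one : IsCaratheodory (fun _ => 1) :=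
  ⟨differentiableOn_const _, rfl, fun _ _ => by simp⟩

lemma isCompactLocallyUniformly_classTHO : IsCompactLocallyUniformly classTHO := by
  have ht0 : (0 : ℝ) ∈ Icc (-1 : ℝ) 1 := by norm_num
  obtain ⟨H₀, hH₀⟩ := exists_isShear_shear isCaratheodory_one (isTypicallyReal_robertsonKernel ht0)
    (deriv_robertsonKernel_zero ht0)
  refine isCompact_iff_ultrafilter_le_nhds.2 fun 𝒰 h𝒰 => ?_
  -- outside the class, the data are chosen arbitrarily
  have hdata : ∀ φ : unitDisk →ᵤ[{K : Set unitDisk | IsCompact K}] ℂ, ∃ f p F H, IsShear f p F H ∧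
      (φ ∈ UniformOnFun.ofFun {K : Set unitDisk | IsCompact K} '' classTHO →
        φ = UniformOnFun.ofFun {K : Set unitDisk | IsCompact K} f) := fun φ => by
    by_cases hφ : φ ∈ UniformOnFun.ofFun {K : Set unitDisk | IsCompact K} '' classTHO
    · obtain ⟨f, hf, rfl⟩ := hφ
      obtain ⟨p, F, H, hs⟩ := exists_isShear hf
      exact ⟨f, p, F, H, hs, fun _ => rfl⟩
    · exact ⟨_, _, _, _, hH₀, fun h => absurd h hφ⟩
  choose f p F H hs hφ using hdata
  obtain ⟨hbp, hbF, hbH⟩ := isLocallyBoundedFamily_of_isShear hs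
  obtain ⟨p₀, hp₀⟩ := hbp.exists_tendstoLocallyUniformlyOn
    (fun i => (hs i).isCaratheodory.diff) 𝒰
  obtain ⟨F₀, hF₀⟩ := hbF.exists_tendstoLocallyUniformlyOn
    (fun i => (hs i).isTypicallyReal.diff) 𝒰
  obtain ⟨H₁, hH₁⟩ := hbH.exists_tendstoLocallyUniformlyOn (fun i => (hs i).diff) 𝒰
  refine ⟨UniformOnFun.ofFun _ _,
    mem_image_of_mem _ (IsShear.of_tendsto hs hp₀ hF₀ hH₁).mem_classTHO, ?_⟩
  have hlim : Tendsto id (𝒰 : Filter (unitDisk →ᵤ[{K : Set unitDisk | IsCompact K}] ℂ))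
      (𝓝 (UniformOnFun.ofFun _ fun z : unitDisk =>
        ((H₁ z).re : ℂ) + Complex.I * ((F₀ z).im : ℂ))) := by
    rw [UniformOnFun.tendsto_iff_tendstoUniformlyOn]
    intro K hK
    have hK' : IsCompact (Subtype.val '' K : Set ℂ) :=
      IsCompact.image hK continuous_subtype_val
    have hKs : (Subtype.val '' K : Set ℂ) ⊆ unitDisk := by
      rintro _ ⟨z, -, rfl⟩; exact z.2
    have h1 := (tendstoLocallyUniformlyOn_iff_forall_isCompact isOpen_ball).1 hF₀ _ hKs hK'
    have h2 := (tendstoLocallyUniformlyOn_iff_forall_isCompact isOpen_ball).1 hH₁ _ hKs hK'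
    rw [Metric.tendstoUniformlyOn_iff] at h1 h2 ⊢
    intro ε hε
    filter_upwards [h1 (ε / 2) (by positivity), h2 (ε / 2) (by positivity),
      le_principal_iff.1 h𝒰] with φ e1 e2 hm z hz
    have e1 := e1 z ⟨z, hz, rfl⟩
    have e2 := e2 z ⟨z, hz, rfl⟩
    have e3 : (UniformOnFun.toFun {K : Set unitDisk | IsCompact K} ∘ id) φ z = f φ z := by
      rw [Function.comp_apply, id]
      nth_rw 1 [hφ φ hm]
      rfl
    rw [e3, (hs φ).eq z, UniformOnFun.toFun_ofFun, dist_eq_norm,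
      show ((H₁ z).re : ℂ) + Complex.I * ((F₀ z).im : ℂ)
        - (((H φ z).re : ℂ) + Complex.I * ((F φ z).im : ℂ))
        = ((H₁ z - H φ z).re : ℂ) + Complex.I * ((F₀ z - F φ z).im : ℂ) by
          simp only [Complex.sub_re, Complex.sub_im]; push_cast; ring]
    refine (norm_add_le _ _).trans_lt ?_
    rw [norm_mul, Complex.norm_I, one_mul, Complex.norm_real, Complex.norm_real, Real.norm_eq_abs,
      Real.norm_eq_abs]
    rw [dist_eq_norm] at e1 e2
    linarith [Complex.abs_re_le_norm (H₁ z - H φ z), Complex.abs_im_le_norm (F₀ z - F φ z)]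
  exact hlim

/-! ### Extreme points -/

lemma hasDerivAt_lin_comb {F₁ F₂ : ℂ → ℂ} (h₁ : DifferentiableOn ℂ F₁ unitDisk)
    (h₂ : DifferentiableOn ℂ F₂ unitDisk) (a b : ℂ) {z : ℂ} (hz : z ∈ unitDisk) :
    HasDerivAt (fun z => a * F₁ z + b * F₂ z) (a * deriv F₁ z + b * deriv F₂ z) z :=
  ((differentiableAt_of_mem h₁ hz).hasDerivAt.const_mul a).fun_add
    ((differentiableAt_of_mem h₂ hz).hasDerivAt.const_mul b)

/-- A linear combination of shears, in terms of the data. -/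
lemma IsShear.eq_lin_comb_iff {f f₁ f₂ : unitDisk → ℂ} {p F H p₁ F₁ H₁ p₂ F₂ H₂ : ℂ → ℂ}
    (h : IsShear f p F H) (h₁ : IsShear f₁ p₁ F₁ H₁) (h₂ : IsShear f₂ p₂ F₂ H₂) {a b : ℝ} :
    a • f₁ + b • f₂ = f ↔ EqOn F (fun z => a * F₁ z + b * F₂ z) unitDisk ∧
      ∀ z ∈ unitDisk,
        p z * deriv F z = a * (p₁ z * deriv F₁ z) + b * (p₂ z * deriv F₂ z) := by
  have hF₁ := h₁.isTypicallyReal.diff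
  have hF₂ := h₂.isTypicallyReal.diff
  have hdF : DifferentiableOn ℂ (fun z => a * F₁ z + b * F₂ z) unitDisk := fun z hz =>
    (hasDerivAt_lin_comb hF₁ hF₂ a b hz).differentiableAt.differentiableWithinAt
  have hdH : DifferentiableOn ℂ (fun z => a * H₁ z + b * H₂ z) unitDisk := fun z hz =>
    (hasDerivAt_lin_comb h₁.diff h₂.diff a b hz).differentiableAt.differentiableWithinAt
  have hH0 : H 0 = a * H₁ 0 + b * H₂ 0 := by simp [h.map_zero, h₁.map_zero, h₂.map_zero]
  have hF0 : F 0 = a * F₁ 0 + b * F₂ 0 := by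
    simp [h.isTypicallyReal.map_zero, h₁.isTypicallyReal.map_zero, h₂.isTypicallyReal.map_zero]
  constructor
  · intro he
    have hv : ∀ z (hz : z ∈ unitDisk), (a : ℂ) * f₁ ⟨z, hz⟩ + b * f₂ ⟨z, hz⟩ = f ⟨z, hz⟩ :=
      fun z hz => by simpa using congrFun he ⟨z, hz⟩
    have hH : EqOn H (fun z => a * H₁ z + b * H₂ z) unitDisk :=
      eqOn_of_re_eq h.diff hdH hH0 fun z hz => by
        have := congrArg Complex.re (hv z hz)
        rw [h.eq, h₁.eq, h₂.eq] at this
        simpa using this.symm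
    refine ⟨eqOn_of_im_eq h.isTypicallyReal.diff hdF hF0 fun z hz => ?_, fun z hz => ?_⟩
    · have := congrArg Complex.im (hv z hz)
      rw [h.eq, h₁.eq, h₂.eq] at this
      simpa using this.symm
    · rw [← h.deriv_eq z hz, ← h₁.deriv_eq z hz, ← h₂.deriv_eq z hz,
        (hH.eventuallyEq_of_mem (isOpen_ball.mem_nhds hz)).deriv_eq,
        (hasDerivAt_lin_comb h₁.diff h₂.diff a b hz).deriv]
  · rintro ⟨hF, hp⟩
    have hH : EqOn H (fun z => a * H₁ z + b * H₂ z) unitDisk :=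
      eqOn_of_deriv_eq h.diff hdH hH0 fun z hz => by
        rw [(hasDerivAt_lin_comb h₁.diff h₂.diff a b hz).deriv, h.deriv_eq z hz,
          h₁.deriv_eq z hz, h₂.deriv_eq z hz, hp z hz]
    funext z
    have e1 := hH z.2
    have e2 := hF z.2
    simp only at e1 e2
    rw [Pi.add_apply, Pi.smul_apply, Pi.smul_apply, h.eq, h₁.eq, h₂.eq, e1, e2,
      Complex.real_smul, Complex.real_smul, Complex.add_re, Complex.add_im, Complex.re_ofReal_mul,
      Complex.re_ofReal_mul, Complex.im_ofReal_mul, Complex.im_ofReal_mul]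
    push_cast
    ring

/-- If a shear is an extreme point, then so are `p` and `F`. -/
lemma IsShear.isExtreme {f : unitDisk → ℂ} {p F H : ℂ → ℂ} (h : IsShear f p F H)
    (hf : f ∈ Set.extremePoints ℝ classTHO) :
    IsExtremeCaratheodory p ∧ IsExtremeTypicallyReal F := by
  refine ⟨⟨h.isCaratheodory, fun p₁ p₂ hp₁ hp₂ a b ha hb hab he => ?_⟩,
    ⟨h.isTypicallyReal, h.deriv_zero⟩, fun F₁ F₂ hF₁ hF₁' hF₂ hF₂' a b ha hb hab he => ?_⟩
  · obtain ⟨H₁, h₁⟩ := exists_isShear_shear hp₁ h.isTypicallyReal h.deriv_zero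
    obtain ⟨H₂, h₂⟩ := exists_isShear_shear hp₂ h.isTypicallyReal h.deriv_zero
    have hab' : (a : ℂ) + b = 1 := by exact_mod_cast hab
    have hsum := (h.eq_lin_comb_iff h₁ h₂ (a := a) (b := b)).2
      ⟨fun z _ => by linear_combination -(F z) * hab',
        fun z hz => by rw [he hz]; ring⟩
    have := hf.2 h₁.mem_classTHO h₂.mem_classTHO ⟨a, b, ha, hb, hab, hsum⟩
    rw [this] at h₁
    exact (h₁.unique h).2
  · obtain ⟨H₁, h₁⟩ := exists_isShear_shear h.isCaratheodory hF₁ hF₁'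
    obtain ⟨H₂, h₂⟩ := exists_isShear_shear h.isCaratheodory hF₂ hF₂'
    have hsum := (h.eq_lin_comb_iff h₁ h₂ (a := a) (b := b)).2 ⟨he, fun z hz => by
      rw [(he.eventuallyEq_of_mem (isOpen_ball.mem_nhds hz)).deriv_eq,
        (hasDerivAt_lin_comb hF₁.diff hF₂.diff a b hz).deriv]; ring⟩
    have := hf.2 h₁.mem_classTHO h₂.mem_classTHO ⟨a, b, ha, hb, hab, hsum⟩
    rw [this] at h₁
    exact (h₁.unique h).1

lemma shear_mem_extremePoints {η : ℂ} (hη : ‖η‖ = 1) {t : ℝ} (ht : t ∈ Icc (-1 : ℝ) 1) :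
    (fun z : unitDisk => shear (herglotzKernel η) (robertsonKernel t) z) ∈
      Set.extremePoints ℝ classTHO := by
  have hp := isCaratheodory_herglotzKernel hη
  have hq := isTypicallyReal_robertsonKernel ht
  obtain ⟨H, h⟩ := exists_isShear_shear hp hq (deriv_robertsonKernel_zero ht)
  refine mem_extremePoints_iff_left.2 ⟨h.mem_classTHO, ?_⟩
  rintro f₁ hf₁ f₂ hf₂ ⟨a, b, ha, hb, hab, he⟩
  obtain ⟨p₁, F₁, H₁, h₁⟩ := exists_isShear hf₁
  obtain ⟨p₂, F₂, H₂, h₂⟩ := exists_isShear hf₂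
  obtain ⟨e1, e2⟩ := (h.eq_lin_comb_iff h₁ h₂).1 he
  have hF₁ := eqOn_robertsonKernel_of_lin_comb h₁.isTypicallyReal h₁.deriv_zero
    h₂.isTypicallyReal h₂.deriv_zero ha hb hab ht e1
  have hF₂ := eqOn_robertsonKernel_of_lin_comb h₂.isTypicallyReal h₂.deriv_zero
    h₁.isTypicallyReal h₁.deriv_zero hb ha (by linarith) ht
    (fun z hz => (e1 hz).trans (add_comm _ _))
  have hd₁ := h₁.isCaratheodory.diff
  have hd₂ := h₂.isCaratheodory.diff
  have e3 : EqOn (herglotzKernel η) (fun z => a * p₁ z + b * p₂ z) unitDisk :=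
    eqOn_of_mul_eq hp.diff (by fun_prop) (hq.diff.deriv isOpen_ball)
      (by rw [deriv_robertsonKernel_zero ht]; exact one_ne_zero) fun z hz => by
        rw [e2 z hz, (hF₁.eventuallyEq_of_mem (isOpen_ball.mem_nhds hz)).deriv_eq,
          (hF₂.eventuallyEq_of_mem (isOpen_ball.mem_nhds hz)).deriv_eq]
        ring
  have hp₁ := eqOn_herglotzKernel_of_lin_comb h₁.isCaratheodory h₂.isCaratheodory ha hb hab hη e3
  exact (h₁.congr hp₁ hF₁ hp hq).eq_shear

/-! ### Failure of convexity -/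

lemma deriv_robertsonKernel {t : ℝ} (ht : t ∈ Icc (-1 : ℝ) 1) {z : ℂ} (hz : z ∈ unitDisk) :
    deriv (robertsonKernel t) z = (1 - z ^ 2) / (1 - 2 * (t : ℂ) * z + z ^ 2) ^ 2 := by
  have hne := robertson_denom_ne_zero ht hz
  have h1 : HasDerivAt (fun z : ℂ => 1 - 2 * (t : ℂ) * z + z ^ 2) (-(2 * t * 1) + 2 * z) z := by
    simpa using (((hasDerivAt_id z).const_mul (2 * (t : ℂ))).const_sub 1).fun_add
      ((hasDerivAt_id z).pow 2)
  have h2 := ((hasDerivAt_id z).div h1 hne).deriv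
  refine Eq.trans h2 ?_
  simp only [id]
  congr 1
  ring

/-- At the point `i (√2 - 1)` the derivatives of the Robertson kernels for `t = 1` and `t = -1`
add up to zero, while the Herglotz kernels for `η = 1` and `η = -1` take different values. So the
midpoint of the two shears is not sense-preserving there. -/
lemma not_convex_classTHO : ¬ Convex ℝ classTHO := by
  intro hconv
  have t1 : (1 : ℝ) ∈ Icc (-1 : ℝ) 1 := by norm_num
  have t2 : (-1 : ℝ) ∈ Icc (-1 : ℝ) 1 := by norm_num
  obtain ⟨H₁, h₁⟩ := exists_isShear_shear (isCaratheodory_herglotzKernel (η := 1) (by simp))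
    (isTypicallyReal_robertsonKernel t1) (deriv_robertsonKernel_zero t1)
  obtain ⟨H₂, h₂⟩ := exists_isShear_shear (isCaratheodory_herglotzKernel (η := -1) (by simp))
    (isTypicallyReal_robertsonKernel t2) (deriv_robertsonKernel_zero t2)
  have hmid := hconv h₁.mem_classTHO h₂.mem_classTHO (a := 1 / 2) (b := 1 / 2) (by norm_num)
    (by norm_num) (by norm_num)
  obtain ⟨p, F, H, h⟩ := exists_isShear hmid
  obtain ⟨e1, e2⟩ := (h.eq_lin_comb_iff h₁ h₂).1 rfl
  obtain ⟨x, hx0, hx1, hx⟩ : ∃ x : ℝ, 0 < x ∧ x < 1 ∧ x ^ 2 = 1 - 2 * x := by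
    have h2 := Real.sq_sqrt (show (0 : ℝ) ≤ 2 by norm_num)
    have h3 := Real.sqrt_nonneg 2
    exact ⟨√2 - 1, by nlinarith, by nlinarith, by linear_combination h2⟩
  set z : ℂ := x * Complex.I with hzdef
  have hz : z ∈ unitDisk := by
    rw [mem_unitDisk, hzdef, norm_mul, Complex.norm_I, Complex.norm_real,
      Real.norm_of_nonneg hx0.le, mul_one]
    exact hx1
  have hz0 : z ≠ 0 := mul_ne_zero (Complex.ofReal_ne_zero.2 hx0.ne') Complex.I_ne_zero
  have hxc : (x : ℂ) ^ 2 = 1 - 2 * x := by exact_mod_cast hx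
  have hzz : z ^ 2 = -(x : ℂ) ^ 2 := by rw [hzdef, mul_pow, Complex.I_sq]; ring
  have hquad : z ^ 4 + 6 * z ^ 2 + 1 = 0 := by
    rw [show z ^ 4 = (z ^ 2) ^ 2 by ring, hzz]
    linear_combination ((x : ℂ) ^ 2 - 2 * x - 1) * hxc
  have n1 : 1 - z ≠ 0 := one_sub_ne_zero (mem_unitDisk.1 hz)
  have n2 : 1 + z ≠ 0 := by
    have := one_sub_ne_zero (w := -z) (by rw [norm_neg]; exact mem_unitDisk.1 hz)
    rwa [sub_neg_eq_add] at this
  have d1 : deriv (robertsonKernel 1) z = (1 - z ^ 2) / (1 - z) ^ 4 := by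
    rw [deriv_robertsonKernel t1 hz]; push_cast; congr 1; ring
  have d2 : deriv (robertsonKernel (-1)) z = (1 - z ^ 2) / (1 + z) ^ 4 := by
    rw [deriv_robertsonKernel t2 hz]; push_cast; congr 1; ring
  have hsum : deriv (robertsonKernel 1) z + deriv (robertsonKernel (-1)) z = 0 := by
    rw [d1, d2, div_add_div _ _ (pow_ne_zero 4 n1) (pow_ne_zero 4 n2), div_eq_zero_iff]
    left
    linear_combination (1 - z ^ 2) * 2 * hquad
  have hne : deriv (robertsonKernel 1) z ≠ 0 := by
    rw [d1]; exact div_ne_zero (one_sub_sq_ne_zero hz) (pow_ne_zero 4 n1)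
  have hF : deriv F z = 0 := by
    rw [(e1.eventuallyEq_of_mem (isOpen_ball.mem_nhds hz)).deriv_eq,
      (hasDerivAt_lin_comb h₁.isTypicallyReal.diff h₂.isTypicallyReal.diff _ _ hz).deriv]
    push_cast
    linear_combination hsum / 2
  have e3 := e2 z hz
  rw [hF, mul_zero] at e3
  have e4 : (herglotzKernel 1 z - herglotzKernel (-1) z) * deriv (robertsonKernel 1) z = 0 := by
    push_cast at e3
    linear_combination -2 * e3 - herglotzKernel (-1) z * hsum
  have e5 := sub_eq_zero.1 ((mul_eq_zero.1 e4).resolve_right hne)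
  rw [herglotzKernel, herglotzKernel, one_mul, neg_one_mul, sub_neg_eq_add, ← sub_eq_add_neg,
    div_eq_div_iff n1 n2] at e5
  exact hz0 (by linear_combination e5 / 4)

theorem theorem3 :
    IsCompactLocallyUniformly classTHO ∧
    Set.extremePoints ℝ classTHO =
      {f : unitDisk → ℂ | ∃ η : ℂ, ∃ t : ℝ, ‖η‖ = 1 ∧ t ∈ Set.Icc (-1 : ℝ) 1 ∧
        f = fun z : unitDisk => shear (herglotzKernel η) (robertsonKernel t) (z : ℂ)} ∧
    ¬ Convex ℝ classTHO := by
  refine ⟨isCompactLocallyUniformly_classTHO, Subset.antisymm (fun f hf => ?_) ?_,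
    not_convex_classTHO⟩
  · obtain ⟨p, F, H, h⟩ := exists_isShear hf.1
    obtain ⟨hp, hF⟩ := h.isExtreme hf
    obtain ⟨η, hη, hpη⟩ := hp.exists_eqOn_herglotzKernel
    obtain ⟨t, ht, hFt⟩ := hF.exists_eqOn_robertsonKernel
    exact ⟨η, t, hη, ht, (h.congr hpη hFt (isCaratheodory_herglotzKernel hη)
      (isTypicallyReal_robertsonKernel ht)).eq_shear⟩
  · rintro f ⟨η, t, hη, ht, rfl⟩
    exact shear_mem_extremePoints hη ht
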